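/- Let $(\mathbf X,d)$ be a complete length space, let $\Omega\subsetneq \mathbf X$ be a bounded domain (a nonempty connected open set), let $f$ be a uniformly continuous real function on $\Omega$ with $\inf_\Omega f>0$, and let $g\in C(\partial\Omega)$. Consider the eikonal equation $|\nabla u|=f$ in $\Omega$ and functions $u\in \mathrm{Lip}_{loc}(\Omega)$ that satisfy the boundary condition (BC) there is a modulus $\omega_b$ (a continuous increasing function $[0,\infty)\to[0,\infty)$ with $\omega_b(0)=0$) such that $|u(x)-g(y)|\le \omega_b(d(x,y))$ for all $x\in\Omega$, $y\in\partial\Omega$. Then for every such $u$ the following are equivalent: (a) $u$ is a c-solution; (b) $u$ is an s-solution; (c) $u$ is a Monge solution. Moreover, any two functions in $\mathrm{Lip}_{loc}(\Omega)$ that satisfy (BC) with the same $g$ (each with its own modulus), and each of which is a c-solution, an s-solution or a Monge solution, are equal in $\Omega$. Here the notions are as follows. For $S\subset\mathbf X$ and $x\in\mathbf X$, $\mathcal A_x(\mathbb R,S)$ is the set of curves $\gamma:\mathbb R\to S$ parametrized by arc length with $\gamma(0)=x$; $T^+=\inf\{t\ge 0:\gamma(t)\notin\Omega\}$ and $T^-=\sup\{t\le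 0:\gamma(t)\notin\Omega\}$. For a locally Lipschitz $u$, $$|\nabla u|(x)=\limsup_{y\to x}\frac{|u(y)-u(x)|}{d(x,y)},\qquad |\nabla^{\pm} u|(x)=\limsup_{y\to x}\frac{[u(y)-u(x)]_\pm}{d(x,y)},$$ where $[a]_+=\max\{a,0\}$, $[a]_-=-\min\{a,0\}$, and $|\nabla u|^*(x)=\limsup_{y\to x}|\nabla u|(y)$. $\overline{\mathcal C}(\Omega)$ (resp. $\underline{\mathcal C}(\Omega)$) is the set of $\psi\in\mathrm{Lip}_{loc}(\Omega)$ such that $|\nabla\psi|$ is continuous in $\Omega$ and equals $|\nabla^+\psi|$ (resp. $|\nabla^-\psi|$) there. * A c-subsolution is an upper semicontinuous $u$ on $\Omega$ such that for all $x\in\Omega$, $\gamma\in\mathcal A_x(\mathbb R,\Omega)$ and $\phi\in C^1(\mathbb R)$ such that $u\circ\gamma-\phi$ has a local maximum at $0$, $|\phi'(0)|\le f(x)$. A c-supersolution is a lower semicontinuous $u$ on $\Omega$ such that for all $\varepsilon>0$ and $x\in\Omega$ there are $\gamma\in\mathcal A_x(\mathbb R,\mathbf X)$ with $T^\pm$ finite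 and a lower semicontinuous $w:(T^-,T^+)\to\mathbb R$ with $w(0)=u(x)$, $w\ge u\circ\gamma-\varepsilon$, and $|\phi'(t_0)|\ge f(\gamma(t_0))-\varepsilon$ whenever $\phi\in C^1(\mathbb R)$ and $w-\phi$ has a local minimum at $t_0\in(T^-,T^+)$. A c-solution is a continuous function that is both. * An s-subsolution is an upper semicontinuous $u$ on $\Omega$ such that $|\nabla\psi_1|(x)\le f(x)+|\nabla\psi_2|^*(x)$ whenever $\psi_1\in\underline{\mathcal C}(\Omega)$, $\psi_2\in\mathrm{Lip}_{loc}(\Omega)$ and $u-\psi_1-\psi_2$ has a local maximum at $x\in\Omega$. An s-supersolution is a lower semicontinuous $u$ on $\Omega$ such that $|\nabla\psi_1|(x)\ge f(x)-|\nabla\psi_2|^*(x)$ whenever $\psi_1\in\overline{\mathcal C}(\Omega)$, $\psi_2\in\mathrm{Lip}_{loc}(\Omega)$ and $u-\psi_1-\psi_2$ has a local minimum at $x\in\Omega$. An s-solution is a continuous function that is both. * A Monge solution is a $u\in\mathrm{Lip}_{loc}(\Omega)$ with $|\nabla^-u|(x)=f(x)$ for all $x\in\Omega$. -/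

import Mathlib

open Filter Topology Set

noncomputable section

namespace MetricEikonal

/-! Functions on an open set `Ω` of `X` are represented by functions on `X`; every notion below
only depends on their values in `Ω`. -/

variable {X : Type*} [MetricSpace X]

/-- `X` is a length space: any two points are joined by curves whose length is arbitrarily close
to the distance of the points. The length of a curve `γ : [a, b] → X` is its variation. -/
def IsLengthSpace (X : Type*) [MetricSpace X] : Prop :=
  ∀ x y : X, ∀ ε : ℝ, 0 < ε → ∃ (a b : ℝ) (γ : ℝ → X), a ≤ b ∧ ContinuousOn γ (Icc a b) ∧
    γ a = x ∧ γ b = y ∧ eVariationOn γ (Icc a b) ≤ ENNReal.ofReal (dist x y + ε)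

/-! ### Curve-based solutions -/

/-- The class `𝒜_x(ℝ, S)`: curves `γ : ℝ → X` parametrized by arc length (the length of
`γ` on `[s, t]` is `t - s`), with values in `S` and with `γ 0 = x`. -/
def IsAdmissibleCurve (S : Set X) (x : X) (γ : ℝ → X) : Prop :=
  HasUnitSpeedOn γ univ ∧ (∀ t, γ t ∈ S) ∧ γ 0 = x

/-- The curve leaves `Ω` both forward and backward in time, that is, its exit time is `< ∞` and
its entrance time is `> -∞`. -/
def LeavesInFiniteTime (Ω : Set X) (γ : ℝ → X) : Prop :=
  (∃ t : ℝ, 0 ≤ t ∧ γ t ∉ Ω) ∧ ∃ t : ℝ, t ≤ 0 ∧ γ t ∉ Ω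

/-- The exit time `T⁺`; it is only used for curves that leave `Ω` in finite time. -/
def exitTime (Ω : Set X) (γ : ℝ → X) : ℝ := sInf {t : ℝ | 0 ≤ t ∧ γ t ∉ Ω}

/-- The entrance time `T⁻`; it is only used for curves that leave `Ω` in finite time. -/
def entranceTime (Ω : Set X) (γ : ℝ → X) : ℝ := sSup {t : ℝ | t ≤ 0 ∧ γ t ∉ Ω}

/-- c-subsolutions of `|∇u| = f` in `Ω`. -/
def IsCSubsolution (Ω : Set X) (f u : X → ℝ) : Prop :=
  UpperSemicontinuousOn u Ω ∧
  ∀ x ∈ Ω, ∀ γ : ℝ → X, IsAdmissibleCurve Ω x γ →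
    ∀ φ : ℝ → ℝ, ContDiff ℝ 1 φ → IsLocalMax (fun t => u (γ t) - φ t) 0 → |deriv φ 0| ≤ f x

/-- c-supersolutions of `|∇u| = f` in `Ω`. -/
def IsCSupersolution (Ω : Set X) (f u : X → ℝ) : Prop :=
  LowerSemicontinuousOn u Ω ∧
  ∀ ε : ℝ, 0 < ε → ∀ x ∈ Ω, ∃ (γ : ℝ → X) (w : ℝ → ℝ),
    IsAdmissibleCurve univ x γ ∧ LeavesInFiniteTime Ω γ ∧
    LowerSemicontinuousOn w (Ioo (entranceTime Ω γ) (exitTime Ω γ)) ∧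
    w 0 = u x ∧
    (∀ t ∈ Ioo (entranceTime Ω γ) (exitTime Ω γ), u (γ t) - ε ≤ w t) ∧
    ∀ φ : ℝ → ℝ, ContDiff ℝ 1 φ → ∀ t₀ ∈ Ioo (entranceTime Ω γ) (exitTime Ω γ),
      IsLocalMin (fun t => w t - φ t) t₀ → f (γ t₀) - ε ≤ |deriv φ t₀|

/-- c-solutions of `|∇u| = f` in `Ω`. -/
def IsCSolution (Ω : Set X) (f u : X → ℝ) : Prop :=
  ContinuousOn u Ω ∧ IsCSubsolution Ω f u ∧ IsCSupersolution Ω f u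

/-! ### Slopes

The slopes are real-valued upper limits. They are only used for locally Lipschitz functions, for
which the quotients are bounded near the point. -/

/-- The local slope `|∇u|(x)`. -/
def localSlope (u : X → ℝ) (x : X) : ℝ :=
  limsup (fun y => |u y - u x| / dist x y) (𝓝[≠] x)

/-- The super-slope `|∇⁺u|(x)`. -/
def superSlope (u : X → ℝ) (x : X) : ℝ :=
  limsup (fun y => max (u y - u x) 0 / dist x y) (𝓝[≠] x)

/-- The sub-slope `|∇⁻u|(x)`, with `[a]₋ = - min a 0`. -/
def subSlope (u : X → ℝ) (x : X) : ℝ :=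
  limsup (fun y => -min (u y - u x) 0 / dist x y) (𝓝[≠] x)

/-- `|∇ψ|*(x) = limsup_{y → x} |∇ψ|(y)`. -/
def slopeEnvelope (ψ : X → ℝ) (x : X) : ℝ := limsup (localSlope ψ) (𝓝 x)

/-! ### Slope-based solutions -/

/-- The test class `𝒞̄(Ω)`. -/
def UpperTestClass (Ω : Set X) : Set (X → ℝ) :=
  {ψ | LocallyLipschitzOn Ω ψ ∧ (∀ x ∈ Ω, superSlope ψ x = localSlope ψ x) ∧
    ContinuousOn (localSlope ψ) Ω}

/-- The test class `𝒞̲(Ω)`. -/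
def LowerTestClass (Ω : Set X) : Set (X → ℝ) :=
  {ψ | LocallyLipschitzOn Ω ψ ∧ (∀ x ∈ Ω, subSlope ψ x = localSlope ψ x) ∧
    ContinuousOn (localSlope ψ) Ω}

/-- s-subsolutions of `|∇u| = f` in `Ω`. -/
def IsSSubsolution (Ω : Set X) (f u : X → ℝ) : Prop :=
  UpperSemicontinuousOn u Ω ∧
  ∀ ψ₁ ∈ LowerTestClass Ω, ∀ ψ₂ : X → ℝ, LocallyLipschitzOn Ω ψ₂ → ∀ x ∈ Ω,
    IsLocalMax (fun y => u y - ψ₁ y - ψ₂ y) x → localSlope ψ₁ x ≤ f x + slopeEnvelope ψ₂ x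

/-- s-supersolutions of `|∇u| = f` in `Ω`. -/
def IsSSupersolution (Ω : Set X) (f u : X → ℝ) : Prop :=
  LowerSemicontinuousOn u Ω ∧
  ∀ ψ₁ ∈ UpperTestClass Ω, ∀ ψ₂ : X → ℝ, LocallyLipschitzOn Ω ψ₂ → ∀ x ∈ Ω,
    IsLocalMin (fun y => u y - ψ₁ y - ψ₂ y) x → f x - slopeEnvelope ψ₂ x ≤ localSlope ψ₁ x

/-- s-solutions of `|∇u| = f` in `Ω`. -/
def IsSSolution (Ω : Set X) (f u : X → ℝ) : Prop :=
  ContinuousOn u Ω ∧ IsSSubsolution Ω f u ∧ IsSSupersolution Ω f u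

/-! ### Monge solutions -/

/-- Monge subsolutions of `|∇u| = f` in `Ω`. -/
def IsMongeSubsolution (Ω : Set X) (f u : X → ℝ) : Prop :=
  LocallyLipschitzOn Ω u ∧ ∀ x ∈ Ω, subSlope u x ≤ f x

/-- Monge supersolutions of `|∇u| = f` in `Ω`. -/
def IsMongeSupersolution (Ω : Set X) (f u : X → ℝ) : Prop :=
  LocallyLipschitzOn Ω u ∧ ∀ x ∈ Ω, f x ≤ subSlope u x

/-- Monge solutions of `|∇u| = f` in `Ω`. -/
def IsMongeSolution (Ω : Set X) (f u : X → ℝ) : Prop :=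
  IsMongeSubsolution Ω f u ∧ IsMongeSupersolution Ω f u

/-! ### Boundary condition -/

/-- A modulus of continuity `ω : [0, ∞) → [0, ∞)`: continuous, increasing, `ω(0) = 0`. -/
def IsModulus (ω : ℝ → ℝ) : Prop :=
  ContinuousOn ω (Ici 0) ∧ MonotoneOn ω (Ici 0) ∧ ω 0 = 0

/-- The boundary condition `u = g` on `∂Ω`, in the uniform sense
`|u(x) - g(y)| ≤ ω(d(x, y))` for some modulus `ω`. -/
def SatisfiesBoundaryCondition (Ω : Set X) (g u : X → ℝ) : Prop :=
  ∃ ω : ℝ → ℝ, IsModulus ω ∧ ∀ x ∈ Ω, ∀ y ∈ frontier Ω, |u x - g y| ≤ ω (dist x y)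

end MetricEikonal

end

/-!
Write `|∇⁻u|` for the sub-slope of `u`. All three notions of solution are compared with the Monge
notion, and the subsolution and the supersolution parts are treated separately. Functions are
locally Lipschitz throughout, and `f` is positive.

*Subsolutions.* The inequality `|∇⁻u| ≤ f` bounds `u x - u y` from above for `y` near `x`, which
gives the c- and s-subsolution inequalities directly. Conversely, a c-subsolution changes along
every unit speed curve at a rate at most `sup f` by a one-dimensional maximum argument
(`sub_le_of_forall_test`), and almost shortest curves turn this into a slope bound. For an
s-subsolution the radial functions `θ ∘ dist p`, with `θ` nondecreasing and `θ' 0 = 0`, are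
admissible test functions (`radial_slopes`, which uses that `X` is a length space). Since balls
need not be compact, maximum points are replaced by those of Ekeland's principle
(`exists_ekeland`), whose error term is the perturbation `ψ₂` in the definition.

*Supersolutions.* A Monge supersolution descends from the centre of a small ball to its boundary at
any rate below `inf f` (`IsMongeSupersolution.exists_descent`), again by Ekeland's principle, and
descent at all small scales conversely gives `|∇⁻u| ≥ f`. For s-supersolutions the descent is
obtained with radial test functions, and for c-supersolutions by minimizing over a short piece
of the almost optimal curve (`exists_endpoint_descent`). The remaining implication, from Monge to
c-supersolutions, is the only one that is not local: descent steps are concatenated to a curve that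
reaches the boundary (`exists_hasDescentPath`). The step length at `y` is of order
`min δ (ε / (f y + 1))`, where `δ` comes from the uniform continuity of `f`. Each step lowers `u` by
a fixed amount, even when `f` is unbounded, and `u` is bounded by the boundary condition; hence
finitely many steps suffice.

*Uniqueness.* Only Monge solutions have to be compared. If `u > v` somewhere, Ekeland's principle
for `v - λ u` with `λ < 1` close to `1` gives a point away from the boundary where
`|∇⁻v| < f`, a contradiction (`le_of_mongeSubsolution_of_mongeSupersolution`).
-/

namespace MetricEikonal

variable {X : Type*} [MetricSpace X]

/-! ### Curves of unit speed -/

lemma hasUnitSpeedOn_Icc_iff {γ : ℝ → X} {a b : ℝ} :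
    HasUnitSpeedOn γ (Icc a b) ↔ ∀ s t, a ≤ s → s ≤ t → t ≤ b →
      eVariationOn γ (Icc s t) = ENNReal.ofReal (t - s) := by
  unfold HasUnitSpeedOn
  rw [hasConstantSpeedOnWith_iff_ordered]
  constructor
  · intro h s t has hst htb
    have := h (x := s) ⟨has, hst.trans htb⟩ (y := t) ⟨has.trans hst, htb⟩ hst
    rwa [Icc_inter_Icc, sup_of_le_right has, inf_of_le_right htb, NNReal.coe_one, one_mul] at this
  · intro h s hs t ht hst
    rw [Icc_inter_Icc, sup_of_le_right hs.1, inf_of_le_right ht.2, NNReal.coe_one, one_mul]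
    exact h s t hs.1 hst ht.2

lemma hasUnitSpeedOn_univ_iff {γ : ℝ → X} :
    HasUnitSpeedOn γ univ ↔ ∀ s t, s ≤ t →
      eVariationOn γ (Icc s t) = ENNReal.ofReal (t - s) := by
  unfold HasUnitSpeedOn
  rw [hasConstantSpeedOnWith_iff_ordered]
  simp

lemma unitSpeed_dist_le {γ : ℝ → X} {S : Set ℝ} (h : HasUnitSpeedOn γ S) {s t : ℝ}
    (hs : s ∈ S) (ht : t ∈ S) : dist (γ s) (γ t) ≤ |s - t| := by
  wlog hst : s ≤ t generalizing s t
  · rw [dist_comm, abs_sub_comm]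
    exact this ht hs (le_of_not_ge hst)
  have h1 := h hs ht
  have h2 := eVariationOn.edist_le γ (s := S ∩ Icc s t) (x := s) (y := t)
    ⟨hs, le_rfl, hst⟩ ⟨ht, hst, le_rfl⟩
  rw [h1, NNReal.coe_one, one_mul, edist_dist,
    ENNReal.ofReal_le_ofReal_iff (by linarith)] at h2
  rw [abs_sub_comm, abs_of_nonneg (by linarith)]
  exact h2

lemma unitSpeed_continuousOn {γ : ℝ → X} {S : Set ℝ} (h : HasUnitSpeedOn γ S) :
    ContinuousOn γ S := by
  have : LipschitzOnWith 1 γ S := LipschitzOnWith.of_dist_le_mul fun s hs t ht => by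
    simpa [Real.dist_eq] using unitSpeed_dist_le h hs ht
  exact this.continuousOn

lemma unitSpeed_congr {γ σ : ℝ → X} {a b : ℝ} (h : HasUnitSpeedOn γ (Icc a b))
    (hσ : EqOn γ σ (Icc a b)) : HasUnitSpeedOn σ (Icc a b) := by
  rw [hasUnitSpeedOn_Icc_iff] at h ⊢
  intro s t h1 h2 h3
  rw [← h s t h1 h2 h3]
  exact (eVariationOn.congr (hσ.mono (Icc_subset_Icc h1 h3))).symm

lemma unitSpeed_reflect {γ : ℝ → X} {a b : ℝ} (h : HasUnitSpeedOn γ (Icc a b)) (c : ℝ) :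
    HasUnitSpeedOn (fun t => γ (c - t)) (Icc (c - b) (c - a)) := by
  rw [hasUnitSpeedOn_Icc_iff] at h ⊢
  intro s t h1 h2 h3
  have := eVariationOn.comp_eq_of_antitoneOn γ (t := Icc s t) (fun t => c - t)
    (fun _ _ _ _ hxy => by dsimp only; linarith)
  rw [image_const_sub_Icc, h _ _ (by linarith) (by linarith) (by linarith)] at this
  rw [show t - s = c - s - (c - t) by ring]
  exact this

lemma unitSpeed_translate {γ : ℝ → X} {a b : ℝ} (h : HasUnitSpeedOn γ (Icc a b)) (c : ℝ) :
    HasUnitSpeedOn (fun t => γ (t - c)) (Icc (a + c) (b + c)) := by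
  rw [hasUnitSpeedOn_Icc_iff] at h ⊢
  intro s t h1 h2 h3
  have := eVariationOn.comp_eq_of_monotoneOn γ (t := Icc s t) (fun t => t - c)
    (fun _ _ _ _ hxy => by dsimp only; linarith)
  rw [image_sub_const_Icc, h _ _ (by linarith) (by linarith) (by linarith)] at this
  rw [show t - s = t - c - (s - c) by ring]
  exact this

lemma unitSpeed_translate_univ {γ : ℝ → X} (h : HasUnitSpeedOn γ univ) (c : ℝ) :
    HasUnitSpeedOn (fun t => γ (c + t)) univ := by
  rw [hasUnitSpeedOn_univ_iff] at h ⊢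
  intro s t hst
  have := eVariationOn.comp_eq_of_monotoneOn γ (t := Icc s t) (fun t => c + t)
    (fun _ _ _ _ hxy => by dsimp only; linarith)
  rw [image_const_add_Icc, h _ _ (by linarith)] at this
  rw [show t - s = c + t - (c + s) by ring]
  exact this

/-- Concatenation of two curves of unit speed. -/
lemma unitSpeed_concat {σ γ : ℝ → X} {l T : ℝ}
    (hσ : HasUnitSpeedOn σ (Icc 0 l)) (hγ : HasUnitSpeedOn γ (Icc 0 T)) (h : σ l = γ 0) :
    HasUnitSpeedOn (fun t => if t < l then σ t else γ (t - l)) (Icc 0 (T + l)) := by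
  refine HasUnitSpeedOn.Icc_Icc (y := l) ?_ ?_
  · refine unitSpeed_congr hσ fun t ht => ?_
    split_ifs with h1
    · rfl
    · rw [show t = l from le_antisymm ht.2 (not_lt.1 h1), h, sub_self]
  · have := unitSpeed_translate hγ l
    rw [zero_add] at this
    refine unitSpeed_congr this fun t ht => ?_
    rw [if_neg (not_lt.2 ht.1)]

/-- The folding map `ℝ → [0, L]`: the even, `2L`-periodic triangle wave that is the identity on
`[0, L]`. -/
noncomputable def fold (L t : ℝ) : ℝ := L / Real.pi * Real.arccos (Real.cos (Real.pi / L * t))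

lemma fold_mem {L : ℝ} (hL : 0 < L) (t : ℝ) : fold L t ∈ Icc 0 L := by
  have hp := Real.pi_pos
  have h1 := Real.arccos_nonneg (Real.cos (Real.pi / L * t))
  have h2 := Real.arccos_le_pi (Real.cos (Real.pi / L * t))
  refine ⟨by unfold fold; positivity, ?_⟩
  calc fold L t ≤ L / Real.pi * Real.pi := by unfold fold; gcongr
    _ = L := by field_simp

lemma fold_of_mem {L t : ℝ} (hL : 0 < L) (ht : t ∈ Icc 0 L) : fold L t = t := by
  have hp := Real.pi_pos
  have h0 := ht.1
  unfold fold
  rw [Real.arccos_cos (by positivity)]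
  · field_simp
  · calc Real.pi / L * t ≤ Real.pi / L * L := by gcongr; exact ht.2
      _ = Real.pi := by field_simp

lemma fold_neg (L t : ℝ) : fold L (-t) = fold L t := by
  unfold fold
  rw [mul_neg, Real.cos_neg]

lemma fold_add_period {L : ℝ} (hL : 0 < L) (t : ℝ) (n : ℕ) :
    fold L (t - n * (2 * L)) = fold L t := by
  unfold fold
  rw [show Real.pi / L * (t - n * (2 * L)) = Real.pi / L * t - n * (2 * Real.pi) by field_simp,
    Real.cos_sub_nat_mul_two_pi]

/-- A unit speed curve on `[0, L]` extends to a unit speed curve on `ℝ` by running back and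
forth. -/
lemma unitSpeed_comp_fold {γ : ℝ → X} {L : ℝ} (hL : 0 < L) (h : HasUnitSpeedOn γ (Icc 0 L)) :
    HasUnitSpeedOn (fun t => γ (fold L t)) univ := by
  have h0 : HasUnitSpeedOn (fun t => γ (fold L t)) (Icc 0 L) :=
    unitSpeed_congr h fun t ht => by rw [fold_of_mem hL ht]
  have h1 : HasUnitSpeedOn (fun t => γ (fold L t)) (Icc 0 (2 * L)) := by
    refine h0.Icc_Icc ?_
    have := unitSpeed_reflect h0 (2 * L)
    rw [show 2 * L - L = L by ring, sub_zero] at this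
    refine unitSpeed_congr this fun t _ => ?_
    have := fold_add_period hL t 1
    rw [← this, ← fold_neg]
    congr 2
    push_cast; ring
  have h2 : ∀ n : ℕ, HasUnitSpeedOn (fun t => γ (fold L t)) (Icc 0 (n * (2 * L))) := by
    intro n
    induction n with
    | zero =>
      refine hasConstantSpeedOnWith_of_subsingleton _ ?_ _
      simp
    | succ n ih =>
      refine ih.Icc_Icc ?_
      have := unitSpeed_translate h1 (n * (2 * L))
      rw [zero_add, show 2 * L + n * (2 * L) = ((n + 1 : ℕ) : ℝ) * (2 * L) by push_cast; ring]
        at this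
      refine unitSpeed_congr this fun t _ => ?_
      rw [fold_add_period hL]
  have h3 : ∀ n : ℕ, HasUnitSpeedOn (fun t => γ (fold L t))
      (Icc (-(n * (2 * L))) (n * (2 * L))) := by
    intro n
    refine HasUnitSpeedOn.Icc_Icc (y := 0) ?_ (h2 n)
    have := unitSpeed_reflect (h2 n) 0
    rw [zero_sub, sub_zero] at this
    refine unitSpeed_congr this fun t _ => ?_
    rw [zero_sub, fold_neg]
  rw [hasUnitSpeedOn_univ_iff]
  intro s t hst
  obtain ⟨n, hn⟩ := exists_nat_ge ((|s| + |t|) / (2 * L))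
  rw [div_le_iff₀ (by positivity)] at hn
  exact hasUnitSpeedOn_Icc_iff.1 (h3 n) s t
    (by linarith [neg_abs_le s, abs_nonneg t]) hst (by linarith [le_abs_self t, abs_nonneg s])

/-! ### Length spaces -/

lemma continuousOn_variationOnFromTo {γ : ℝ → X} {a b : ℝ} (hab : a ≤ b)
    (hc : ContinuousOn γ (Icc a b)) (hv : LocallyBoundedVariationOn γ (Icc a b)) :
    ContinuousOn (variationOnFromTo γ (Icc a b) a) (Icc a b) := by
  intro t ht
  have ha : a ∈ Icc a b := left_mem_Icc.2 hab
  have h1 : ContinuousWithinAt (variationOnFromTo γ (Icc a b) a) (Icc a b ∩ Iio t) t := by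
    have := variationOnFromTo.tendsto_left ha ht hv ((hc t ht).mono inter_subset_left)
    rwa [dist_self, sub_zero] at this
  have h2 : ContinuousWithinAt (variationOnFromTo γ (Icc a b) a) (Icc a b ∩ Ioi t) t := by
    have := variationOnFromTo.tendsto_right ha ht hv ((hc t ht).mono inter_subset_left)
    rwa [dist_self, add_zero] at this
  refine (continuousWithinAt_insert_self.2 (h1.union h2)).mono fun s hs => ?_
  rcases lt_trichotomy s t with h | h | h
  · exact Or.inr (Or.inl ⟨hs, h⟩)
  · exact Or.inl h
  · exact Or.inr (Or.inr ⟨hs, h⟩)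

/-- In a length space almost shortest curves can be parametrized by arc length. -/
lemma IsLengthSpace.exists_unitSpeed (hX : IsLengthSpace X) (x y : X) {ε : ℝ} (hε : 0 < ε) :
    ∃ (L : ℝ) (γ : ℝ → X), dist x y ≤ L ∧ L ≤ dist x y + ε ∧ HasUnitSpeedOn γ (Icc 0 L) ∧
      γ 0 = x ∧ γ L = y := by
  obtain ⟨a, b, γ, hab, hc, hx, hy, hlen⟩ := hX x y ε hε
  have hbv : BoundedVariationOn γ (Icc a b) := (hlen.trans_lt ENNReal.ofReal_lt_top).ne
  have hv := hbv.locallyBoundedVariationOn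
  have ha : a ∈ Icc a b := left_mem_Icc.2 hab
  have hb : b ∈ Icc a b := right_mem_Icc.2 hab
  have hcont := continuousOn_variationOnFromTo hab hc hv
  have himg := ContinuousOn.surjOn_Icc hcont ha hb
  set V := variationOnFromTo γ (Icc a b) a with hV
  have hVa : V a = 0 := variationOnFromTo.self _ _ _
  have hVb : V b ≤ dist x y + ε := by
    rw [hV, variationOnFromTo.eq_of_le _ _ hab, inter_self]
    exact ENNReal.toReal_le_of_le_ofReal (by positivity) hlen
  have hus := has_unit_speed_naturalParameterization γ hv ha
  rw [← hV] at hus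
  have himg' : V '' Icc a b = Icc 0 (V b) := by
    refine Subset.antisymm ?_ (by rwa [hVa] at himg)
    rintro _ ⟨t, ht, rfl⟩
    have hm := variationOnFromTo.monotoneOn hv ha
    exact ⟨hVa ▸ hm ha ht ht.1, hm ht hb ht.2⟩
  rw [himg'] at hus
  have h0 : naturalParameterization γ (Icc a b) a 0 = x := by
    have := edist_naturalParameterization_eq_zero hv ha ha
    rw [← hV, hVa, edist_eq_zero] at this
    rw [this, hx]
  have h1 : naturalParameterization γ (Icc a b) a (V b) = y := by
    have := edist_naturalParameterization_eq_zero hv ha hb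
    rw [← hV, edist_eq_zero] at this
    rw [this, hy]
  have hVb0 : 0 ≤ V b := hVa ▸ variationOnFromTo.monotoneOn hv ha ha hb hab
  refine ⟨V b, naturalParameterization γ (Icc a b) a, ?_, hVb, hus, h0, h1⟩
  have := unitSpeed_dist_le hus (left_mem_Icc.2 hVb0) (right_mem_Icc.2 hVb0)
  rwa [h0, h1, zero_sub, abs_neg, abs_of_nonneg hVb0] at this

/-- Points almost on a geodesic from `x` to `y`, at a prescribed distance from `x`. -/
lemma IsLengthSpace.exists_between (hX : IsLengthSpace X) (x y : X) {t ε : ℝ} (ht : 0 ≤ t)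
    (hty : t ≤ dist x y) (hε : 0 < ε) :
    ∃ z, dist x z = t ∧ dist z y ≤ dist x y - t + ε := by
  obtain ⟨L, γ, h1, h2, hγ, h0, hL⟩ := hX.exists_unitSpeed x y hε
  have hL0 : 0 ≤ L := dist_nonneg.trans h1
  have hc : ContinuousOn (fun s => dist x (γ s)) (Icc 0 L) :=
    (continuous_const.dist continuous_id).comp_continuousOn (unitSpeed_continuousOn hγ)
  obtain ⟨s, hs, hst⟩ := intermediate_value_Icc hL0 hc (show t ∈ Icc _ _ by
    rw [h0, hL, dist_self]; exact ⟨ht, hty⟩)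
  have e1 := unitSpeed_dist_le hγ hs (left_mem_Icc.2 hL0)
  have e2 := unitSpeed_dist_le hγ hs (right_mem_Icc.2 hL0)
  rw [h0, sub_zero, abs_of_nonneg hs.1, dist_comm] at e1
  rw [hL, abs_sub_comm, abs_of_nonneg (by linarith [hs.2])] at e2
  dsimp only at hst
  exact ⟨γ s, hst, by linarith⟩

lemma IsLengthSpace.neBot (hX : IsLengthSpace X) [Nontrivial X] (x : X) : (𝓝[≠] x).NeBot := by
  rw [← mem_closure_iff_nhdsWithin_neBot, Metric.mem_closure_iff]
  intro ε hε
  obtain ⟨y, hy⟩ := exists_ne x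
  have hd : 0 < dist x y := dist_pos.2 hy.symm
  obtain ⟨z, hz, -⟩ := hX.exists_between x y (t := min (ε / 2) (dist x y)) (by positivity)
    (min_le_right _ _) one_pos
  have hpos : 0 < dist x z := by rw [hz]; positivity
  refine ⟨z, (dist_pos.1 hpos).symm, ?_⟩
  rw [hz]
  exact (min_le_left _ _).trans_lt (by linarith)

lemma IsLengthSpace.exists_frontier (hX : IsLengthSpace X) {Ω : Set X} (hΩ : IsOpen Ω) {x z : X}
    (hx : x ∈ Ω) (hz : z ∉ Ω) {ε : ℝ} (hε : 0 < ε) :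
    ∃ y ∈ frontier Ω, dist x y ≤ dist x z + ε := by
  obtain ⟨L, γ, h1, h2, hγ, h0, hL⟩ := hX.exists_unitSpeed x z hε
  have hL0 : 0 ≤ L := dist_nonneg.trans h1
  have hc := (isPreconnected_Icc (a := (0 : ℝ)) (b := L)).image γ (unitSpeed_continuousOn hγ)
  by_contra! hne
  have key : ∀ y ∈ γ '' Icc 0 L, y ∈ Ω ∨ y ∉ closure Ω := by
    rintro _ ⟨s, hs, rfl⟩
    by_contra! h
    have e1 := unitSpeed_dist_le hγ hs (left_mem_Icc.2 hL0)
    rw [h0, sub_zero, abs_of_nonneg hs.1, dist_comm] at e1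
    refine absurd (hne (γ s) ?_) (by linarith [hs.2])
    rw [hΩ.frontier_eq]
    exact ⟨h.2, h.1⟩
  have hx' : x ∈ γ '' Icc 0 L := ⟨0, left_mem_Icc.2 hL0, h0⟩
  have hz' : z ∈ γ '' Icc 0 L := ⟨L, right_mem_Icc.2 hL0, hL⟩
  obtain ⟨y, -, hy1, hy2⟩ := hc Ω (closure Ω)ᶜ hΩ isClosed_closure.isOpen_compl key
    ⟨x, hx', hx⟩ ⟨z, hz', (key z hz').resolve_left hz⟩
  exact hy2 (subset_closure hy1)

/-! ### Slopes as upper limits of difference quotients -/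

lemma limsup_div_dist_nonneg {N : X → ℝ} {x : X} [(𝓝[≠] x).NeBot] (hN : ∀ y, 0 ≤ N y) :
    0 ≤ limsup (fun y => N y / dist x y) (𝓝[≠] x) := by
  rw [limsup_eq]
  refine Real.sInf_nonneg fun a ha => ?_
  obtain ⟨y, hy⟩ := Eventually.exists (show ∀ᶠ y in 𝓝[≠] x, N y / dist x y ≤ a from ha)
  exact (div_nonneg (hN y) dist_nonneg).trans hy

lemma isCoboundedUnder_div_dist {N : X → ℝ} {x : X} [(𝓝[≠] x).NeBot] (hN : ∀ y, 0 ≤ N y) :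
    IsCoboundedUnder (· ≤ ·) (𝓝[≠] x) (fun y => N y / dist x y) :=
  isCoboundedUnder_le_of_le _ (x := 0) fun y => div_nonneg (hN y) dist_nonneg

lemma isBoundedUnder_div_dist {N : X → ℝ} {x : X} {C : ℝ}
    (hC : ∀ᶠ y in 𝓝 x, N y ≤ C * dist x y) :
    IsBoundedUnder (· ≤ ·) (𝓝[≠] x) (fun y => N y / dist x y) := by
  refine isBoundedUnder_of_eventually_le (a := C) ?_
  filter_upwards [hC.filter_mono nhdsWithin_le_nhds, self_mem_nhdsWithin] with y hy hne
  exact (div_le_iff₀ (dist_pos.2 (Ne.symm hne))).2 hy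

lemma limsup_div_dist_le {N : X → ℝ} {x : X} {K : ℝ} [(𝓝[≠] x).NeBot] (hN : ∀ y, 0 ≤ N y)
    (h : ∀ ε > 0, ∀ᶠ y in 𝓝 x, N y ≤ (K + ε) * dist x y) :
    limsup (fun y => N y / dist x y) (𝓝[≠] x) ≤ K := by
  refine le_of_forall_pos_le_add fun ε hε => ?_
  refine limsup_le_of_le (isCoboundedUnder_div_dist hN) ?_
  filter_upwards [(h ε hε).filter_mono nhdsWithin_le_nhds, self_mem_nhdsWithin] with y hy hne
  exact (div_le_iff₀ (dist_pos.2 (Ne.symm hne))).2 hy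

lemma eventually_of_limsup_div_dist_lt {N : X → ℝ} {x : X} {C K : ℝ} (hx : N x = 0)
    (hC : ∀ᶠ y in 𝓝 x, N y ≤ C * dist x y)
    (h : limsup (fun y => N y / dist x y) (𝓝[≠] x) < K) :
    ∀ᶠ y in 𝓝 x, N y ≤ K * dist x y := by
  have h1 := eventually_lt_of_limsup_lt h (isBoundedUnder_div_dist hC)
  rw [eventually_nhdsWithin_iff] at h1
  filter_upwards [h1] with y hy
  by_cases hne : y = x
  · simp [hne, hx]
  · exact ((div_lt_iff₀ (dist_pos.2 (Ne.symm hne))).1 (hy hne)).le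

lemma frequently_of_lt_limsup_div_dist {N : X → ℝ} {x : X} {K : ℝ} [(𝓝[≠] x).NeBot]
    (hN : ∀ y, 0 ≤ N y) (h : K < limsup (fun y => N y / dist x y) (𝓝[≠] x)) :
    ∃ᶠ y in 𝓝[≠] x, K * dist x y < N y := by
  have h1 := frequently_lt_of_lt_limsup (isCoboundedUnder_div_dist hN) h
  refine (h1.and_eventually self_mem_nhdsWithin).mono fun y hy => ?_
  exact (lt_div_iff₀ (dist_pos.2 (Ne.symm hy.2))).1 hy.1

lemma le_limsup_div_dist {N : X → ℝ} {x : X} {C K : ℝ}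
    (hC : ∀ᶠ y in 𝓝 x, N y ≤ C * dist x y) (h : ∃ᶠ y in 𝓝[≠] x, K * dist x y ≤ N y) :
    K ≤ limsup (fun y => N y / dist x y) (𝓝[≠] x) := by
  refine le_limsup_of_frequently_le ?_ (isBoundedUnder_div_dist hC)
  refine (h.and_eventually self_mem_nhdsWithin).mono fun y hy => ?_
  exact (le_div_iff₀ (dist_pos.2 (Ne.symm hy.2))).2 hy.1

lemma neg_min_nonneg (a : ℝ) : 0 ≤ -min a 0 := by
  rw [neg_nonneg]
  exact min_le_right _ _

lemma neg_min_le_iff {a b : ℝ} (hb : 0 ≤ b) : -min a 0 ≤ b ↔ -a ≤ b := by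
  rw [neg_le, le_min_iff, neg_le]
  exact and_iff_left (by linarith)

section LocallyLipschitz

variable {Ω : Set X} {u : X → ℝ} {x : X}

lemma exists_lipschitz_nhds (hΩ : IsOpen Ω) (hu : LocallyLipschitzOn Ω u) (hx : x ∈ Ω) :
    ∃ K : ℝ, 0 ≤ K ∧ ∃ t ∈ 𝓝 x, ∀ y ∈ t, ∀ z ∈ t, |u y - u z| ≤ K * dist y z := by
  obtain ⟨K, t, ht, hK⟩ := hu hx
  rw [hΩ.nhdsWithin_eq hx] at ht
  exact ⟨K, K.2, t, ht, fun y hy z hz => hK.dist_le_mul y hy z hz⟩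

lemma exists_abs_sub_le (hΩ : IsOpen Ω) (hu : LocallyLipschitzOn Ω u) (hx : x ∈ Ω) :
    ∃ K : ℝ, 0 ≤ K ∧ ∀ᶠ y in 𝓝 x, |u y - u x| ≤ K * dist x y := by
  obtain ⟨K, hK, t, ht, h⟩ := exists_lipschitz_nhds hΩ hu hx
  refine ⟨K, hK, ?_⟩
  filter_upwards [ht] with y hy
  rw [dist_comm]
  exact h y hy x (mem_of_mem_nhds ht)

lemma exists_sub_part_le (hΩ : IsOpen Ω) (hu : LocallyLipschitzOn Ω u) (hx : x ∈ Ω) :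
    ∃ K : ℝ, ∀ᶠ y in 𝓝 x, -min (u y - u x) 0 ≤ K * dist x y := by
  obtain ⟨K, hK, h⟩ := exists_abs_sub_le hΩ hu hx
  refine ⟨K, h.mono fun y hy => ?_⟩
  rw [neg_min_le_iff (by positivity)]
  exact (neg_le_abs _).trans hy

lemma eventually_of_subSlope_lt (hΩ : IsOpen Ω) (hu : LocallyLipschitzOn Ω u) (hx : x ∈ Ω)
    {K : ℝ} (h : subSlope u x < K) : ∀ᶠ y in 𝓝 x, u x - u y ≤ K * dist x y := by
  obtain ⟨C, hC⟩ := exists_sub_part_le hΩ hu hx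
  filter_upwards [eventually_of_limsup_div_dist_lt (by simp) hC h] with y hy
  linarith [min_le_left (u y - u x) 0]

lemma subSlope_le [(𝓝[≠] x).NeBot] {K : ℝ} (hK : 0 ≤ K)
    (h : ∀ ε > 0, ∀ᶠ y in 𝓝 x, u x - u y ≤ (K + ε) * dist x y) : subSlope u x ≤ K := by
  refine limsup_div_dist_le (fun _ => neg_min_nonneg _) fun ε hε => ?_
  filter_upwards [h ε hε] with y hy
  rw [neg_min_le_iff (by positivity)]
  linarith

lemma frequently_of_lt_subSlope [(𝓝[≠] x).NeBot] {K : ℝ} (hK : 0 ≤ K) (h : K < subSlope u x) :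
    ∃ᶠ y in 𝓝[≠] x, K * dist x y < u x - u y := by
  refine (frequently_of_lt_limsup_div_dist (fun _ => neg_min_nonneg _) h).mono fun y hy => ?_
  by_contra! hlt
  have := (neg_min_le_iff (a := u y - u x) (b := K * dist x y) (by positivity)).2 (by linarith)
  linarith

lemma le_subSlope (hΩ : IsOpen Ω) (hu : LocallyLipschitzOn Ω u) (hx : x ∈ Ω) {K : ℝ}
    (h : ∃ᶠ y in 𝓝[≠] x, K * dist x y ≤ u x - u y) : K ≤ subSlope u x := by
  obtain ⟨C, hC⟩ := exists_sub_part_le hΩ hu hx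
  refine le_limsup_div_dist hC (h.mono fun y hy => hy.trans ?_)
  linarith [min_le_left (u y - u x) 0]

lemma subSlope_nonneg [(𝓝[≠] x).NeBot] : 0 ≤ subSlope u x :=
  limsup_div_dist_nonneg fun _ => neg_min_nonneg _

lemma localSlope_nonneg [(𝓝[≠] x).NeBot] : 0 ≤ localSlope u x :=
  limsup_div_dist_nonneg fun _ => abs_nonneg _

lemma localSlope_le [(𝓝[≠] x).NeBot] {K : ℝ}
    (h : ∀ ε > 0, ∀ᶠ y in 𝓝 x, |u y - u x| ≤ (K + ε) * dist x y) : localSlope u x ≤ K :=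
  limsup_div_dist_le (fun _ => abs_nonneg _) h

lemma eventually_of_localSlope_lt (hΩ : IsOpen Ω) (hu : LocallyLipschitzOn Ω u) (hx : x ∈ Ω)
    {K : ℝ} (h : localSlope u x < K) : ∀ᶠ y in 𝓝 x, |u y - u x| ≤ K * dist x y := by
  obtain ⟨C, -, hC⟩ := exists_abs_sub_le hΩ hu hx
  exact eventually_of_limsup_div_dist_lt (by simp) hC h

lemma subSlope_le_localSlope (hΩ : IsOpen Ω) (hu : LocallyLipschitzOn Ω u) (hx : x ∈ Ω)
    [(𝓝[≠] x).NeBot] : subSlope u x ≤ localSlope u x := by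
  refine subSlope_le localSlope_nonneg fun ε hε => ?_
  filter_upwards [eventually_of_localSlope_lt hΩ hu hx (lt_add_of_pos_right _ hε)] with y hy
  linarith [neg_le_abs (u y - u x)]

lemma superSlope_neg (u : X → ℝ) (x : X) : superSlope (-u) x = subSlope u x := by
  unfold superSlope subSlope
  congr 1
  ext y
  rw [← max_neg_neg, Pi.neg_apply, Pi.neg_apply, neg_zero]
  congr 2
  ring

lemma localSlope_neg (u : X → ℝ) : localSlope (-u) = localSlope u := by
  ext x
  unfold localSlope
  congr 1
  ext y
  rw [Pi.neg_apply, Pi.neg_apply, ← abs_neg]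
  congr 2
  ring

/-- For a locally Lipschitz function the upper semicontinuous envelope dominates the slope. -/
lemma localSlope_le_slopeEnvelope (hΩ : IsOpen Ω) (hu : LocallyLipschitzOn Ω u) (hx : x ∈ Ω)
    (hne : ∀ y : X, (𝓝[≠] y).NeBot) : localSlope u x ≤ slopeEnvelope u x := by
  obtain ⟨K, hK, t, ht, h⟩ := exists_lipschitz_nhds hΩ hu hx
  refine le_limsup_of_frequently_le (frequently_iff.2 fun hU => ⟨x, mem_of_mem_nhds hU, le_rfl⟩) ?_
  refine isBoundedUnder_of_eventually_le (a := K) ?_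
  filter_upwards [eventually_mem_nhds_iff.2 ht] with y hy
  refine localSlope_le fun ε hε => ?_
  filter_upwards [hy] with z hz
  have := h z hz y (mem_of_mem_nhds hy)
  rw [dist_comm z y] at this
  have h2 : 0 ≤ ε * dist y z := by positivity
  linarith

lemma slopeEnvelope_le (hne : ∀ y : X, (𝓝[≠] y).NeBot) {K : ℝ}
    (h : ∀ y z, |u y - u z| ≤ K * dist y z) : slopeEnvelope u x ≤ K := by
  refine limsup_le_of_le (isCoboundedUnder_le_of_le _ (x := 0) fun y => localSlope_nonneg) ?_
  refine Eventually.of_forall fun y => localSlope_le fun ε hε => Eventually.of_forall fun z => ?_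
  have := h z y
  rw [dist_comm z y] at this
  have h2 : 0 ≤ ε * dist y z := by positivity
  linarith

end LocallyLipschitz

/-! ### Ekeland's variational principle -/

/-- Ekeland's variational principle for a continuous function on a closed set. -/
theorem exists_ekeland [CompleteSpace X] {S : Set X} (hS : IsClosed S) {F : X → ℝ}
    (hF : ContinuousOn F S) {B : ℝ} (hB : ∀ x ∈ S, B ≤ F x) {ε : ℝ} (hε : 0 < ε) {x₀ : X}
    (hx₀ : x₀ ∈ S) :
    ∃ y ∈ S, F y + ε * dist x₀ y ≤ F x₀ ∧ ∀ z ∈ S, z ≠ y → F y < F z + ε * dist y z := by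
  let A : X → Set X := fun x => {z | z ∈ S ∧ F z + ε * dist x z ≤ F x}
  have hself : ∀ x ∈ S, x ∈ A x := fun x hx => ⟨hx, by simp⟩
  have htrans : ∀ x y z, y ∈ A x → z ∈ A y → z ∈ A x := fun x y z hy hz =>
    ⟨hz.1, by nlinarith [hy.2, hz.2, dist_triangle x y z]⟩
  have hstep : ∀ (n : ℕ) (x : S), ∃ z : S, (z : X) ∈ A x ∧
      ∀ w ∈ A x, F z ≤ F w + 1 / ((n : ℝ) + 1) := by
    intro n x
    have hne : (F '' A x).Nonempty := ⟨F x, x, hself x x.2, rfl⟩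
    have hbd : BddBelow (F '' A x) := ⟨B, by rintro _ ⟨z, hz, rfl⟩; exact hB z hz.1⟩
    obtain ⟨_, ⟨z, hz, rfl⟩, hlt⟩ :=
      Real.lt_sInf_add_pos hne (ε := 1 / ((n : ℝ) + 1)) (by positivity)
    exact ⟨⟨z, hz.1⟩, hz, fun w hw => by linarith [csInf_le hbd ⟨w, hw, rfl⟩]⟩
  choose step hstep1 hstep2 using hstep
  let s : ℕ → S := fun n => Nat.rec ⟨x₀, hx₀⟩ (fun n x => step n x) n
  have hs : ∀ n, s (n + 1) = step n (s n) := fun n => rfl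
  have hmem : ∀ n m : ℕ, n ≤ m → (s m).1 ∈ A (s n).1 := by
    intro n m hnm
    induction m, hnm using Nat.le_induction with
    | base => exact hself _ (s n).2
    | succ m _ ih => exact htrans _ _ _ ih (by rw [hs]; exact hstep1 m (s m))
  have hanti : Antitone fun n => F (s n).1 := fun n m hnm => by
    have h1 := (hmem n m hnm).2
    have h2 : 0 ≤ ε * dist (s n).1 (s m) := by positivity
    dsimp only
    linarith
  have hbdd : BddBelow (range fun n => F (s n).1) := ⟨B, by rintro _ ⟨n, rfl⟩; exact hB _ (s n).2⟩
  have hlim := tendsto_atTop_ciInf hanti hbdd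
  have hcauchy : CauchySeq fun n => (s n).1 := by
    rw [Metric.cauchySeq_iff']
    intro δ hδ
    obtain ⟨N, hN⟩ := Metric.cauchySeq_iff'.1 hlim.cauchySeq (ε * δ) (by positivity)
    refine ⟨N, fun n hn => ?_⟩
    have h1 := (hmem N n hn).2
    have h2 := (neg_le_abs _).trans_lt (hN n hn)
    rw [dist_comm]
    refine lt_of_mul_lt_mul_left ?_ hε.le
    linarith
  obtain ⟨y, hy⟩ := cauchySeq_tendsto_of_complete hcauchy
  have hyS : y ∈ S := hS.mem_of_tendsto hy (Eventually.of_forall fun n => (s n).2)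
  have hFy : Tendsto (fun n => F (s n).1) atTop (𝓝 (F y)) :=
    (hF y hyS).tendsto.comp (tendsto_nhdsWithin_iff.2 ⟨hy, Eventually.of_forall fun n => (s n).2⟩)
  have hyA : ∀ n, y ∈ A (s n).1 := fun n => by
    refine ⟨hyS, le_of_tendsto (hFy.add ((tendsto_const_nhds.dist hy).const_mul ε)) ?_⟩
    filter_upwards [eventually_ge_atTop n] with m hm
    exact (hmem n m hm).2
  refine ⟨y, hyS, (hyA 0).2, fun z hz hne => ?_⟩
  by_contra! hle
  have hzA : z ∈ A y := ⟨hz, hle⟩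
  have h1 : F y ≤ F z := by
    have hone := tendsto_one_div_add_atTop_nhds_zero_nat (𝕜 := ℝ)
    have := hone.const_add (F z)
    rw [add_zero] at this
    refine le_of_tendsto_of_tendsto' ((tendsto_add_atTop_iff_nat 1).2 hFy) this fun n => ?_
    rw [hs]
    exact hstep2 n (s n) z (htrans _ _ _ (hyA n) hzA)
  have h2 : 0 < ε * dist y z := mul_pos hε (dist_pos.2 hne.symm)
  linarith

/-! ### Radial test functions -/

section Radial

variable {θ θ' : ℝ → ℝ}

lemma radial_lipschitz (hd : ∀ s, HasDerivAt θ (θ' s) s) (hc : Continuous θ') (p : X)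
    (Ω : Set X) : LocallyLipschitzOn Ω (fun z => θ (dist p z)) := by
  have h1 : ContDiff ℝ 1 θ := by
    rw [contDiff_one_iff_deriv]
    refine ⟨fun s => (hd s).differentiableAt, ?_⟩
    rwa [show deriv θ = θ' from funext fun s => (hd s).deriv]
  have h2 : LocallyLipschitz fun z : X => θ (dist p z) :=
    h1.locallyLipschitz.comp (LipschitzWith.dist_right p).locallyLipschitz
  exact h2.locallyLipschitzOn

lemma radial_eventually (hd : ∀ s, HasDerivAt θ (θ' s) s) (p z : X) {ε : ℝ} (hε : 0 < ε) :
    ∀ᶠ y in 𝓝 z, |θ (dist p y) - θ (dist p z) - θ' (dist p z) * (dist p y - dist p z)| ≤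
      ε * |dist p y - dist p z| := by
  have h1 := (hasDerivAt_iff_isLittleO.1 (hd (dist p z))).def hε
  have h2 : Tendsto (fun y => dist p y) (𝓝 z) (𝓝 (dist p z)) :=
    tendsto_const_nhds.dist tendsto_id
  filter_upwards [h2.eventually h1] with y hy
  simpa [mul_comm] using hy

/-- A radial function `θ ∘ dist p` has slope `θ' ∘ dist p`, and the slope is attained by moving
towards the centre `p`, where `θ` decreases. -/
lemma radial_slopes (hX : IsLengthSpace X) (hne : ∀ y : X, (𝓝[≠] y).NeBot)
    (hd : ∀ s, HasDerivAt θ (θ' s) s) (hc : Continuous θ') (h0 : θ' 0 = 0)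
    (hpos : ∀ s, 0 ≤ θ' s) (p z : X) :
    subSlope (fun z => θ (dist p z)) z = θ' (dist p z) ∧
      localSlope (fun z => θ (dist p z)) z = θ' (dist p z) := by
  have hlip := radial_lipschitz hd hc p (univ : Set X)
  have hup : localSlope (fun z => θ (dist p z)) z ≤ θ' (dist p z) := by
    refine localSlope_le fun ε hε => ?_
    filter_upwards [radial_eventually hd p z hε] with y hy
    have h1 : |dist p y - dist p z| ≤ dist z y := by
      have := abs_dist_sub_le y z p
      rwa [dist_comm y p, dist_comm z p, dist_comm y z] at this
    have h2 := abs_sub_abs_le_abs_sub (θ (dist p y) - θ (dist p z))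
      (θ' (dist p z) * (dist p y - dist p z))
    rw [abs_mul, abs_of_nonneg (hpos _)] at h2
    nlinarith [hpos (dist p z)]
  have hmid := subSlope_le_localSlope isOpen_univ hlip (mem_univ z)
  suffices hlow : θ' (dist p z) ≤ subSlope (fun z => θ (dist p z)) z from
    ⟨le_antisymm (hmid.trans hup) hlow, le_antisymm hup (hlow.trans hmid)⟩
  rcases eq_or_ne z p with rfl | hzp
  · rw [dist_self, h0]
    exact subSlope_nonneg
  have hdz : 0 < dist p z := dist_pos.2 hzp.symm
  refine le_of_forall_pos_le_add fun ε hε => ?_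
  by_contra! hlt
  set a := θ' (dist p z) with ha
  -- approach the centre up to a relative error `ρ`
  obtain ⟨ρ, hρ, hρ1, hρε⟩ : ∃ ρ, 0 < ρ ∧ ρ < 1 ∧ a * ρ ≤ ε / 4 := by
    refine ⟨min (1 / 2) (ε / (4 * (a + 1))), by have := hpos (dist p z); positivity,
      (min_le_left _ _).trans_lt (by norm_num), ?_⟩
    have hp := hpos (dist p z)
    calc a * min (1 / 2) (ε / (4 * (a + 1))) ≤ (a + 1) * (ε / (4 * (a + 1))) := by
          gcongr
          · linarith
          · exact min_le_right _ _
      _ = ε / 4 := by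
          have : a + 1 ≠ 0 := by linarith
          field_simp
  have hev := eventually_of_subSlope_lt isOpen_univ hlip (mem_univ z)
    (show subSlope (fun z => θ (dist p z)) z < a - ε by linarith)
  obtain ⟨r, hr, hball⟩ := Metric.eventually_nhds_iff.1
    (hev.and (radial_eventually hd p z (show 0 < ε / 4 by positivity)))
  set t := min (r / 2) (dist p z) with ht
  have htpos : 0 < t := by positivity
  obtain ⟨y, hy1, hy2⟩ := hX.exists_between z p (t := t) (ε := t * ρ) htpos.le
    (by rw [dist_comm]; exact min_le_right _ _) (by positivity)
  obtain ⟨e1, e2⟩ := hball (y := y)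
    (by rw [dist_comm, hy1]; exact (min_le_left _ _).trans_lt (by linarith))
  rw [hy1] at e1
  rw [dist_comm y p, dist_comm z p] at hy2
  have h3 : dist p z ≤ t + dist p y := by
    have := dist_triangle p y z
    rw [dist_comm y z, hy1] at this
    linarith
  rw [abs_of_nonpos (show dist p y - dist p z ≤ 0 by nlinarith)] at e2
  have e3 := (abs_le.1 e2).2
  have h4 : a * (t - t * ρ) ≤ a * (dist p z - dist p y) :=
    mul_le_mul_of_nonneg_left (by linarith) (hpos _)
  have h5 : a * ρ * t ≤ ε / 4 * t := by gcongr
  nlinarith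

lemma radial_mem_lowerTestClass (hX : IsLengthSpace X) (hne : ∀ y : X, (𝓝[≠] y).NeBot)
    (hd : ∀ s, HasDerivAt θ (θ' s) s) (hc : Continuous θ') (h0 : θ' 0 = 0)
    (hpos : ∀ s, 0 ≤ θ' s) (p : X) (Ω : Set X) :
    (fun z => θ (dist p z)) ∈ LowerTestClass Ω := by
  have h := radial_slopes hX hne hd hc h0 hpos p
  refine ⟨radial_lipschitz hd hc p Ω, fun x _ => (h x).1.trans (h x).2.symm, ?_⟩
  rw [show localSlope (fun z => θ (dist p z)) = fun z => θ' (dist p z) from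
    funext fun z => (h z).2]
  exact (hc.comp (continuous_const.dist continuous_id)).continuousOn

lemma neg_mem_upperTestClass {Ω : Set X} {ψ : X → ℝ} (h : ψ ∈ LowerTestClass Ω) :
    -ψ ∈ UpperTestClass Ω := by
  refine ⟨fun x hx => ?_, fun x hx => ?_, ?_⟩
  · obtain ⟨K, t, ht, hK⟩ := h.1 hx
    exact ⟨K, t, ht, hK.neg⟩
  · rw [superSlope_neg, localSlope_neg]
    exact h.2.1 x hx
  · rw [localSlope_neg]
    exact h.2.2

end Radial

/-! ### A family of radial profiles -/

lemma hasDerivAt_max_sq (s : ℝ) : HasDerivAt (fun t : ℝ => max t 0 ^ 2) (2 * max s 0) s := by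
  rcases lt_trichotomy s 0 with h | rfl | h
  · have : (fun t : ℝ => max t 0 ^ 2) =ᶠ[𝓝 s] fun _ => 0 := by
      filter_upwards [Iio_mem_nhds h] with t ht
      rw [max_eq_right (le_of_lt ht)]
      norm_num
    rw [max_eq_right h.le, mul_zero]
    exact (hasDerivAt_const s (0 : ℝ)).congr_of_eventuallyEq this
  · rw [max_self, mul_zero, hasDerivAt_iff_isLittleO_nhds_zero]
    have h1 : (fun h : ℝ => h ^ 2) =o[𝓝 0] fun h : ℝ => h := by
      simpa using Asymptotics.isLittleO_pow_id (one_lt_two)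
    refine Asymptotics.IsBigO.trans_isLittleO (Asymptotics.IsBigO.of_bound 1 ?_) h1
    refine Eventually.of_forall fun h => ?_
    simp only [zero_add, max_self, smul_zero, sub_zero, one_mul, norm_pow, Real.norm_eq_abs,
      zero_pow two_ne_zero]
    refine pow_le_pow_left₀ (abs_nonneg _) ?_ 2
    rcases le_total h 0 with h0 | h0
    · rw [max_eq_right h0, abs_zero]; exact abs_nonneg _
    · rw [max_eq_left h0]
  · have : (fun t : ℝ => max t 0 ^ 2) =ᶠ[𝓝 s] fun t => t ^ 2 := by
      filter_upwards [Ioi_mem_nhds h] with t ht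
      rw [max_eq_left (le_of_lt ht)]
    rw [max_eq_left h.le]
    simpa using (hasDerivAt_pow 2 s).congr_of_eventuallyEq this

/-- The profile of the radial test functions. It vanishes to second order at `0`, has slope `M`
on `[δ, ρ]`, and is strengthened by the quadratic barrier `c (s - ρ)²` beyond `ρ`. -/
noncomputable def profile (M δ c ρ s : ℝ) : ℝ :=
  M / (2 * δ) * (max s 0 ^ 2 - max (s - δ) 0 ^ 2) + c * max (s - ρ) 0 ^ 2

/-- The derivative of `profile`. -/
noncomputable def profileDeriv (M δ c ρ s : ℝ) : ℝ :=
  M / δ * (max s 0 - max (s - δ) 0) + 2 * c * max (s - ρ) 0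

section Profile

variable {M δ c ρ s : ℝ}

lemma hasDerivAt_profile (M c ρ s : ℝ) (hδ : 0 < δ) :
    HasDerivAt (profile M δ c ρ) (profileDeriv M δ c ρ s) s := by
  have h1 : ∀ a : ℝ, HasDerivAt (fun t : ℝ => max (t - a) 0 ^ 2) (2 * max (s - a) 0) s := fun a => by
    simpa using (hasDerivAt_max_sq (s - a)).comp_sub_const s a
  have h2 := (((hasDerivAt_max_sq s).sub (h1 δ)).const_mul (M / (2 * δ))).add ((h1 ρ).const_mul c)
  refine h2.congr_deriv ?_
  unfold profileDeriv
  field_simp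

lemma continuous_profileDeriv : Continuous (profileDeriv M δ c ρ) := by
  unfold profileDeriv
  fun_prop

lemma profileDeriv_zero (hδ : 0 < δ) (hρ : 0 ≤ ρ) : profileDeriv M δ c ρ 0 = 0 := by
  simp [profileDeriv, hδ.le, hρ]

lemma profileDeriv_nonneg (hM : 0 ≤ M) (hδ : 0 < δ) (hc : 0 ≤ c) (s : ℝ) :
    0 ≤ profileDeriv M δ c ρ s := by
  have : max (s - δ) 0 ≤ max s 0 := max_le_max (by linarith) le_rfl
  have h2 : 0 ≤ M / δ * (max s 0 - max (s - δ) 0) := mul_nonneg (by positivity) (by linarith)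
  unfold profileDeriv
  positivity

lemma profileDeriv_le (hM : 0 ≤ M) (hδ : 0 < δ) (hs : s ≤ ρ) : profileDeriv M δ c ρ s ≤ M := by
  have h1 : max s 0 - max (s - δ) 0 ≤ δ := by
    rcases le_total s 0 with h | h
    · rw [max_eq_right h]
      linarith [le_max_right (s - δ) 0]
    · rw [max_eq_left h]
      linarith [le_max_left (s - δ) 0]
  unfold profileDeriv
  rw [max_eq_right (show s - ρ ≤ 0 by linarith), mul_zero, add_zero]
  calc M / δ * (max s 0 - max (s - δ) 0) ≤ M / δ * δ := by gcongr
    _ = M := by field_simp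

lemma le_profileDeriv (hδ : 0 < δ) (hc : 0 ≤ c) (hs : δ ≤ s) : M ≤ profileDeriv M δ c ρ s := by
  unfold profileDeriv
  rw [max_eq_left (show 0 ≤ s by linarith), max_eq_left (show 0 ≤ s - δ by linarith), sub_sub_cancel,
    div_mul_cancel₀ _ hδ.ne']
  have : 0 ≤ 2 * c * max (s - ρ) 0 := by positivity
  linarith

lemma profile_zero (hδ : 0 < δ) (hρ : 0 ≤ ρ) : profile M δ c ρ 0 = 0 := by
  simp [profile, hδ.le, hρ]

lemma profile_le (hM : 0 ≤ M) (hδ : 0 < δ) (h0 : 0 ≤ s) (hs : s ≤ ρ) :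
    profile M δ c ρ s ≤ M * s := by
  unfold profile
  rw [max_eq_right (show s - ρ ≤ 0 by linarith), max_eq_left h0]
  have h1 : s ^ 2 - max (s - δ) 0 ^ 2 ≤ 2 * δ * s := by
    rcases le_total s δ with h | h
    · rw [max_eq_right (by linarith)]
      nlinarith
    · rw [max_eq_left (by linarith)]
      nlinarith
  calc M / (2 * δ) * (s ^ 2 - max (s - δ) 0 ^ 2) + c * 0 ^ 2
      ≤ M / (2 * δ) * (2 * δ * s) + c * 0 ^ 2 := by gcongr
    _ = M * s := by field_simp; ring

lemma profile_ge (hM : 0 ≤ M) (hδ : 0 < δ) (h0 : 0 ≤ s) :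
    M * (s - δ / 2) + c * max (s - ρ) 0 ^ 2 ≤ profile M δ c ρ s := by
  unfold profile
  rw [max_eq_left h0]
  have h1 : 2 * δ * (s - δ / 2) ≤ s ^ 2 - max (s - δ) 0 ^ 2 := by
    rcases le_total s δ with h | h
    · rw [max_eq_right (by linarith)]
      nlinarith [sq_nonneg (s - δ)]
    · rw [max_eq_left (by linarith)]
      nlinarith
  have h2 : M * (s - δ / 2) = M / (2 * δ) * (2 * δ * (s - δ / 2)) := by field_simp
  rw [h2]
  gcongr

lemma profile_nonneg (hM : 0 ≤ M) (hδ : 0 < δ) (hc : 0 ≤ c) (s : ℝ) : 0 ≤ profile M δ c ρ s := by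
  have h1 : max (s - δ) 0 ^ 2 ≤ max s 0 ^ 2 := by
    have := le_max_right (s - δ) 0
    gcongr
    linarith
  have h2 : 0 ≤ M / (2 * δ) * (max s 0 ^ 2 - max (s - δ) 0 ^ 2) :=
    mul_nonneg (by positivity) (by linarith)
  unfold profile
  positivity

end Profile

/-! ### Subsolutions -/

section Sub

variable {Ω : Set X} {f u : X → ℝ}

lemma IsMongeSubsolution.eventually_le (hΩ : IsOpen Ω) (hu : IsMongeSubsolution Ω f u) {x : X}
    (hx : x ∈ Ω) {K : ℝ} (hK : f x < K) : ∀ᶠ y in 𝓝 x, u x - u y ≤ K * dist x y :=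
  eventually_of_subSlope_lt hΩ hu.1 hx ((hu.2 x hx).trans_lt hK)

/-- A Monge subsolution decreases along a unit speed curve at a rate at most `M` if
`f < M` there. -/
lemma IsMongeSubsolution.sub_le_of_unitSpeed (hΩ : IsOpen Ω) (hu : IsMongeSubsolution Ω f u)
    {γ : ℝ → X} {L M : ℝ} (hL : 0 ≤ L) (hM : 0 ≤ M) (hγ : HasUnitSpeedOn γ (Icc 0 L))
    (hγΩ : ∀ t ∈ Icc 0 L, γ t ∈ Ω) (hf : ∀ t ∈ Icc 0 L, f (γ t) < M) :
    u (γ 0) - u (γ L) ≤ M * L := by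
  have hcu : ContinuousOn (fun t => u (γ t)) (Icc 0 L) :=
    hu.1.continuousOn.comp (unitSpeed_continuousOn hγ) hγΩ
  have hcl : IsClosed ({t | u (γ 0) - u (γ t) ≤ M * t} ∩ Icc 0 L) := by
    have : IsClosed {t ∈ Icc 0 L | u (γ 0) - u (γ t) ≤ M * t} :=
      isClosed_Icc.isClosed_le (continuousOn_const.sub hcu) (by fun_prop)
    convert this using 1
    ext t
    exact and_comm
  refine hcl.Icc_subset_of_forall_exists_gt (by simp) (fun t ht b hb => ?_) (right_mem_Icc.2 hL)
  have htI : t ∈ Icc 0 L := Ico_subset_Icc_self ht.2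
  have hev := hu.eventually_le hΩ (hγΩ t htI) (hf t htI)
  have htend : Tendsto γ (𝓝[Icc 0 L] t) (𝓝 (γ t)) := unitSpeed_continuousOn hγ t htI
  have h1 : ∀ᶠ s in 𝓝[>] t, u (γ t) - u (γ s) ≤ M * dist (γ t) (γ s) ∧ s ∈ Ioc t (min b L) := by
    have hmem : Ioc t (min b L) ∈ 𝓝[>] t := Ioc_mem_nhdsGT (lt_min hb ht.2.2)
    refine Eventually.and ?_ hmem
    rw [← nhdsWithin_Ioc_eq_nhdsGT ht.2.2]
    exact (htend.mono_left (nhdsWithin_mono _ fun s hs =>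
      ⟨htI.1.trans hs.1.le, hs.2⟩)).eventually hev
  obtain ⟨s, hs1, hs2⟩ := h1.exists
  have hsL : s ≤ L := hs2.2.trans (min_le_right _ _)
  refine ⟨s, ?_, hs2.1, hs2.2.trans (min_le_left _ _)⟩
  have hd := unitSpeed_dist_le hγ htI (show s ∈ Icc 0 L from ⟨htI.1.trans hs2.1.le, hsL⟩)
  rw [abs_sub_comm, abs_of_nonneg (by linarith [hs2.1])] at hd
  have h3 : M * dist (γ t) (γ s) ≤ M * (s - t) := by gcongr
  have h4 : u (γ 0) - u (γ t) ≤ M * t := ht.1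
  show u (γ 0) - u (γ s) ≤ M * s
  linarith

/-- A Monge subsolution increases along a unit speed curve at a rate at most `M` if
`f < M` there. -/
lemma IsMongeSubsolution.sub_le_of_unitSpeed' (hΩ : IsOpen Ω) (hu : IsMongeSubsolution Ω f u)
    {γ : ℝ → X} {L M : ℝ} (hL : 0 ≤ L) (hM : 0 ≤ M) (hγ : HasUnitSpeedOn γ (Icc 0 L))
    (hγΩ : ∀ t ∈ Icc 0 L, γ t ∈ Ω) (hf : ∀ t ∈ Icc 0 L, f (γ t) < M) :
    u (γ L) - u (γ 0) ≤ M * L := by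
  have h1 := unitSpeed_reflect hγ L
  rw [sub_self, sub_zero] at h1
  have h2 : ∀ t ∈ Icc 0 L, L - t ∈ Icc 0 L := fun t ht => ⟨by linarith [ht.2], by linarith [ht.1]⟩
  simpa using hu.sub_le_of_unitSpeed hΩ hL hM h1 (fun t ht => hγΩ _ (h2 t ht))
    (fun t ht => hf _ (h2 t ht))

theorem IsMongeSubsolution.isCSubsolution (hΩ : IsOpen Ω) (hu : IsMongeSubsolution Ω f u)
    (hf0 : ∀ x ∈ Ω, 0 ≤ f x) : IsCSubsolution Ω f u := by
  refine ⟨hu.1.continuousOn.upperSemicontinuousOn, fun x hx γ hγ φ hφ hmax => ?_⟩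
  have hφ' : HasDerivAt φ (deriv φ 0) 0 := (hφ.differentiable one_ne_zero 0).hasDerivAt
  refine le_of_forall_pos_le_add fun ε hε => ?_
  have hK : 0 ≤ f x + ε / 2 := by linarith [hf0 x hx]
  have hc : Tendsto γ (𝓝 0) (𝓝 (γ 0)) :=
    (continuousOn_univ.1 (unitSpeed_continuousOn hγ.1)).tendsto 0
  rw [hγ.2.2] at hc
  have h1 := hc.eventually (hu.eventually_le hΩ hx (show f x < f x + ε / 2 by linarith))
  have h2 := (hasDerivAt_iff_isLittleO_nhds_zero.1 hφ').def (half_pos hε)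
  have key : ∀ᶠ t in 𝓝 (0 : ℝ), -(deriv φ 0 * t) ≤ (f x + ε) * |t| := by
    filter_upwards [h1, h2, hmax] with t e1 e2 e3
    have hd := unitSpeed_dist_le hγ.1 (mem_univ 0) (mem_univ t)
    rw [zero_sub, abs_neg, hγ.2.2] at hd
    simp only [zero_add, smul_eq_mul, Real.norm_eq_abs] at e2
    have e4 := (abs_le.1 e2).2
    have e5 : (f x + ε / 2) * dist x (γ t) ≤ (f x + ε / 2) * |t| := by gcongr
    rw [hγ.2.2] at e3
    linarith
  obtain ⟨r, hr, hball⟩ := Metric.eventually_nhds_iff.1 key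
  have k1 := hball (y := r / 2) (by rw [Real.dist_0_eq_abs, abs_of_pos (by positivity)]; linarith)
  have k2 := hball (y := -(r / 2))
    (by rw [Real.dist_0_eq_abs, abs_neg, abs_of_pos (by positivity)]; linarith)
  rw [abs_of_pos (by positivity)] at k1
  rw [abs_neg, abs_of_pos (by positivity)] at k2
  rw [abs_le]
  constructor <;> by_contra! h <;> nlinarith

theorem IsMongeSubsolution.isSSubsolution (hΩ : IsOpen Ω) (hne : ∀ y : X, (𝓝[≠] y).NeBot)
    (hu : IsMongeSubsolution Ω f u) (hf0 : ∀ x ∈ Ω, 0 ≤ f x) : IsSSubsolution Ω f u := by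
  refine ⟨hu.1.continuousOn.upperSemicontinuousOn, fun ψ₁ hψ₁ ψ₂ hψ₂ x hx hmax => ?_⟩
  have henv := localSlope_le_slopeEnvelope hΩ hψ₂ hx hne
  have h0 : 0 ≤ localSlope ψ₂ x := localSlope_nonneg
  by_contra! hlt
  rw [← hψ₁.2.1 x hx] at hlt
  set ε := (subSlope ψ₁ x - (f x + slopeEnvelope ψ₂ x)) / 4 with hε
  have hε0 : 0 < ε := by rw [hε]; linarith
  have h1 := hu.eventually_le hΩ hx (show f x < f x + ε by linarith)
  have h2 := eventually_of_localSlope_lt hΩ hψ₂ hx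
    (show localSlope ψ₂ x < localSlope ψ₂ x + ε by linarith)
  have h3 := frequently_of_lt_subSlope (u := ψ₁) (x := x) (K := subSlope ψ₁ x - ε)
    (by linarith [hf0 x hx]) (by linarith)
  obtain ⟨y, ⟨⟨e3, e1⟩, e2, e4⟩, e5⟩ :=
    ((h3.and_eventually (h1.filter_mono nhdsWithin_le_nhds)).and_eventually
      ((h2.filter_mono nhdsWithin_le_nhds).and (hmax.filter_mono nhdsWithin_le_nhds))).and_eventually
      self_mem_nhdsWithin |>.exists
  have hd : 0 < dist x y := dist_pos.2 (Ne.symm e5)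
  have e6 := le_abs_self (ψ₂ y - ψ₂ x)
  dsimp only at e4
  have : (subSlope ψ₁ x - ε) * dist x y < (f x + ε + (localSlope ψ₂ x + ε)) * dist x y := by
    linarith
  have := lt_of_mul_lt_mul_right this hd.le
  linarith

/-- In dimension one, a continuous function whose test functions from above have slope at most
`M` increases at a rate at most `M`. -/
lemma sub_le_of_forall_test {H : ℝ → ℝ} (hH : Continuous H) {M : ℝ}
    (hM : 0 ≤ M) (h : ∀ φ : ℝ → ℝ, ContDiff ℝ 1 φ → ∀ t, IsLocalMax (fun s => H s - φ s) t →
      |deriv φ t| ≤ M) {a b : ℝ} (hab : a ≤ b) : H b - H a ≤ M * (b - a) := by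
  refine le_of_forall_pos_le_add fun η hη => ?_
  by_contra! hlt
  set M' := M + η / (b - a + 1) with hM'
  have hpos : 0 < b - a + 1 := by linarith
  have hMM : M < M' := by rw [hM']; linarith [div_pos hη hpos]
  have hlt' : M' * (b - a) < H b - H a := by
    have : η / (b - a + 1) * (b - a) ≤ η := by
      rw [div_mul_eq_mul_div, div_le_iff₀ hpos]
      nlinarith
    rw [hM', add_mul]
    linarith
  set C := |H (b + 1) - H b| with hC
  -- the quadratic term, which sets in at `b`, keeps the maximum away from `b + 1`
  let φ : ℝ → ℝ := fun t => M' * (t - a) + C * max (t - b) 0 ^ 2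
  have hd : ∀ t, HasDerivAt φ (M' + C * (2 * max (t - b) 0)) t := fun t => by
    have h1 : HasDerivAt (fun t : ℝ => max (t - b) 0 ^ 2) (2 * max (t - b) 0) t := by
      simpa using (hasDerivAt_max_sq (t - b)).comp_sub_const t b
    have h2 : HasDerivAt (fun t : ℝ => M' * (t - a)) M' t := by
      simpa using ((hasDerivAt_id t).sub_const a).const_mul M'
    exact h2.add (h1.const_mul C)
  have hφ : ContDiff ℝ 1 φ := by
    rw [contDiff_one_iff_deriv]
    refine ⟨fun t => (hd t).differentiableAt, ?_⟩
    rw [show deriv φ = fun t => M' + C * (2 * max (t - b) 0) from funext fun t => (hd t).deriv]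
    fun_prop
  obtain ⟨t, ht, hmax⟩ := isCompact_Icc.exists_isMaxOn (nonempty_Icc.2 (show a ≤ b + 1 by linarith))
    (hH.sub hφ.continuous).continuousOn
  have hb := hmax (show b ∈ Icc a (b + 1) from ⟨hab, by linarith⟩)
  simp only [Pi.sub_apply, mem_ofPred_eq, φ, sub_self, max_self] at hb
  have hta : t ≠ a := by
    rintro rfl
    rw [max_eq_right (show t - b ≤ 0 by linarith)] at hb
    nlinarith
  have htb : t ≠ b + 1 := by
    rintro rfl
    rw [add_sub_cancel_left, max_eq_left zero_le_one] at hb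
    nlinarith [le_abs_self (H (b + 1) - H b)]
  have hnhds : Icc a (b + 1) ∈ 𝓝 t :=
    Icc_mem_nhds (lt_of_le_of_ne ht.1 hta.symm) (lt_of_le_of_ne ht.2 htb)
  have := h φ hφ t (hmax.isLocalMax hnhds)
  rw [(hd t).deriv] at this
  have h3 : 0 ≤ C * (2 * max (t - b) 0) := by positivity
  linarith [le_abs_self (M' + C * (2 * max (t - b) 0))]

/-- A good neighbourhood of a point: a ball in `Ω` on which `f` differs from its value at the
centre by less than `ε`, and on which `u` is Lipschitz. -/
lemma exists_good_ball (hΩ : IsOpen Ω) (hf : ContinuousOn f Ω) (hu : LocallyLipschitzOn Ω u)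
    {x : X} (hx : x ∈ Ω) {ε : ℝ} (hε : 0 < ε) :
    ∃ r K : ℝ, 0 < r ∧ 0 ≤ K ∧ Metric.ball x r ⊆ Ω ∧
      (∀ y ∈ Metric.ball x r, |f y - f x| < ε) ∧
      ∀ y ∈ Metric.ball x r, ∀ z ∈ Metric.ball x r, |u y - u z| ≤ K * dist y z := by
  obtain ⟨K, hK, t, ht, hlip⟩ := exists_lipschitz_nhds hΩ hu hx
  have h1 := Metric.continuousAt_iff'.1 (hf.continuousAt (hΩ.mem_nhds hx)) ε hε
  obtain ⟨r, hr, hball⟩ := Metric.mem_nhds_iff.1 (inter_mem (inter_mem (hΩ.mem_nhds hx) ht) h1)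
  exact ⟨r, K, hr, hK, fun y hy => (hball hy).1.1, fun y hy => (hball hy).2,
    fun y hy z hz => hlip y (hball hy).1.2 z (hball hz).1.2⟩

/-- A c-subsolution is a Monge subsolution: the one-dimensional lemma applies along almost
shortest curves, run back and forth to be defined on all of `ℝ`. -/
theorem IsCSubsolution.isMongeSubsolution (hX : IsLengthSpace X) (hΩ : IsOpen Ω)
    (hne : ∀ y : X, (𝓝[≠] y).NeBot) (hf : ContinuousOn f Ω) (hf0 : ∀ x ∈ Ω, 0 ≤ f x)
    (hlip : LocallyLipschitzOn Ω u) (hu : IsCSubsolution Ω f u) : IsMongeSubsolution Ω f u := by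
  refine ⟨hlip, fun x hx => subSlope_le (hf0 x hx) fun ε hε => ?_⟩
  obtain ⟨r, K, hr, -, hrΩ, hfr, -⟩ := exists_good_ball hΩ hf hlip hx hε
  filter_upwards [Metric.ball_mem_nhds x (half_pos hr)] with y hy
  rw [Metric.mem_ball'] at hy
  have hM : 0 ≤ f x + ε := by linarith [hf0 x hx]
  rcases eq_or_ne x y with rfl | hxy
  · simp
  have hdpos : 0 < dist x y := dist_pos.2 hxy
  -- along almost shortest curves from `y` to `x`
  have hstep : ∀ η > 0, η < r / 2 → u x - u y ≤ (f x + ε) * (dist x y + η) := by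
    intro η hη hηr
    obtain ⟨L, γ, hL1, hL2, hγ, hγ0, hγL⟩ := hX.exists_unitSpeed y x hη
    rw [dist_comm] at hL1 hL2
    have hL : 0 < L := hdpos.trans_le hL1
    have hγr : ∀ t ∈ Icc 0 L, γ t ∈ Metric.ball x r := fun t ht => by
      have := unitSpeed_dist_le hγ ht (right_mem_Icc.2 hL.le)
      rw [hγL, abs_sub_comm, abs_of_nonneg (by linarith [ht.2])] at this
      rw [Metric.mem_ball]
      linarith [ht.1]
    have hsp := unitSpeed_comp_fold hL hγ
    have hHc : Continuous fun t => u (γ (fold L t)) := by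
      rw [← continuousOn_univ]
      exact hlip.continuousOn.comp (unitSpeed_continuousOn hsp)
        fun t _ => hrΩ (hγr _ (fold_mem hL t))
    have := sub_le_of_forall_test hHc hM (fun φ hφ t hmax => ?_) hL.le
    · rw [fold_of_mem hL (right_mem_Icc.2 hL.le), fold_of_mem hL (left_mem_Icc.2 hL.le), hγ0, hγL,
        sub_zero] at this
      exact this.trans (by gcongr)
    · have hz := hγr _ (fold_mem hL t)
      have hφ' : ContDiff ℝ 1 fun s => φ (t + s) := hφ.comp (contDiff_const.add contDiff_id)
      have key := hu.2 (γ (fold L t)) (hrΩ hz) (fun s => γ (fold L (t + s)))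
        ⟨unitSpeed_translate_univ hsp t, fun s => hrΩ (hγr _ (fold_mem hL _)), by simp⟩ _ hφ' ?_
      · have hder : deriv (fun s => φ (t + s)) 0 = deriv φ t := by
          rw [deriv_comp_const_add, add_zero]
        rw [hder] at key
        linarith [(abs_lt.1 (hfr _ hz)).2]
      · have ht : Tendsto (fun s : ℝ => t + s) (𝓝 0) (𝓝 t) := by
          have : Continuous fun s : ℝ => t + s := by fun_prop
          simpa using this.tendsto 0
        unfold IsLocalMax IsMaxFilter at hmax ⊢
        simpa using ht.eventually hmax
  refine le_of_forall_pos_le_add fun κ hκ => ?_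
  set η := min (r / 4) (κ / (f x + ε + 1)) with hη
  have hη0 : 0 < η := by positivity
  have h1 := hstep η hη0 ((min_le_left _ _).trans_lt (by linarith))
  have h2 : (f x + ε) * η ≤ κ := by
    have : η ≤ κ / (f x + ε + 1) := min_le_right _ _
    rw [le_div_iff₀ (by linarith)] at this
    nlinarith
  linarith

lemma mul_dist_lipschitz (a : ℝ) (p : X) (Ω : Set X) :
    LocallyLipschitzOn Ω (fun z => a * dist p z) := by
  have h : LocallyLipschitz fun z : X => a * dist p z :=
    (contDiff_const.mul contDiff_id : ContDiff ℝ 1 fun s : ℝ => a * s).locallyLipschitz.comp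
      (LipschitzWith.dist_right p).locallyLipschitz
  exact h.locallyLipschitzOn

lemma slopeEnvelope_mul_dist_le (hne : ∀ y : X, (𝓝[≠] y).NeBot) (a : ℝ) (p x : X) :
    slopeEnvelope (fun z => a * dist p z) x ≤ |a| := by
  refine slopeEnvelope_le hne fun y z => ?_
  rw [← mul_sub, abs_mul, dist_comm p y, dist_comm p z]
  gcongr
  exact abs_dist_sub_le y z p

/-- An s-subsolution is a Monge subsolution. For `y` near `x`, Ekeland's principle gives an almost
maximum point of `u` minus a radial profile centred at `y`. The profile is steeper than `f` away
from `y`, so that this point is close to `y`, and the comparison with the value at `x` bounds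
`u x - u y`. -/
theorem IsSSubsolution.isMongeSubsolution [CompleteSpace X] (hX : IsLengthSpace X) (hΩ : IsOpen Ω)
    (hne : ∀ y : X, (𝓝[≠] y).NeBot) (hf : ContinuousOn f Ω) (hf0 : ∀ x ∈ Ω, 0 ≤ f x)
    (hlip : LocallyLipschitzOn Ω u) (hu : IsSSubsolution Ω f u) : IsMongeSubsolution Ω f u := by
  refine ⟨hlip, fun x hx => subSlope_le (hf0 x hx) fun ε hε => ?_⟩
  obtain ⟨r, K, hr, hK, hrΩ, hfr, hKr⟩ := exists_good_ball hΩ hf hlip hx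
    (show 0 < ε / 2 by positivity)
  set R := r / 2 with hR
  have hR0 : 0 < R := by positivity
  filter_upwards [Metric.ball_mem_nhds x (half_pos hR0)] with y hy
  rw [Metric.mem_ball'] at hy
  set M := f x + ε with hM
  have hM0 : 0 ≤ M := by linarith [hf0 x hx]
  have hyx : dist y x < R / 2 := by rwa [dist_comm]
  have hsub : ∀ z ∈ Metric.closedBall y R, z ∈ Metric.ball x r := fun z hz => by
    rw [Metric.mem_closedBall] at hz
    rw [Metric.mem_ball]
    linarith [dist_triangle z y x]
  refine le_of_forall_pos_le_add fun κ hκ => ?_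
  obtain ⟨δ, hδ0, hδR, hKδ⟩ : ∃ δ, 0 < δ ∧ δ ≤ R ∧ K * δ ≤ κ := by
    refine ⟨min R (κ / (K + 1)), by positivity, min_le_left _ _, ?_⟩
    calc K * min R (κ / (K + 1)) ≤ (K + 1) * (κ / (K + 1)) := by
          gcongr
          · linarith
          · exact min_le_right _ _
      _ = κ := by field_simp
  -- the barrier constant keeps the maximum point away from the sphere of radius `R`
  set c := 4 * (M + 2 * K + 1) / R with hc
  have hc0 : 0 ≤ c := by positivity
  let θ := profile M δ c (R / 2)
  have hd := fun s => hasDerivAt_profile (δ := δ) M c (R / 2) s hδ0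
  have hψ₁ := radial_mem_lowerTestClass hX hne hd continuous_profileDeriv
    (profileDeriv_zero hδ0 (by positivity)) (profileDeriv_nonneg hM0 hδ0 hc0) y Ω
  have hcu : ContinuousOn u (Metric.closedBall y R) :=
    hlip.continuousOn.mono fun z hz => hrΩ (hsub z hz)
  have hcθ : Continuous fun z => θ (dist y z) :=
    (continuous_iff_continuousAt.2 fun s => (hd s).continuousAt).comp
      (continuous_const.dist continuous_id)
  have hxS : x ∈ Metric.closedBall y R := by
    rw [Metric.mem_closedBall']
    linarith
  have hub : ∀ z ∈ Metric.closedBall y R, u z - u x ≤ K * (2 * R) := fun z hz => by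
    have h1 := (le_abs_self _).trans (hKr z (hsub z hz) x (Metric.mem_ball_self hr))
    have h2 := Metric.mem_ball.1 (hsub z hz)
    have h3 : K * dist z x ≤ K * (2 * R) := by
      gcongr
      linarith
    linarith
  obtain ⟨y', hy'S, hy'1, hy'2⟩ := exists_ekeland (Metric.isClosed_closedBall (x := y) (ε := R))
    (F := fun z => θ (dist y z) - u z) (hcθ.continuousOn.sub hcu) (B := -(u x + K * (2 * R)))
    (fun z hz => by
      have := profile_nonneg (ρ := R / 2) hM0 hδ0 hc0 (dist y z)
      linarith [hub z hz]) (show 0 < ε / 4 by positivity) hxS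
  have hθx : θ (dist y x) ≤ M * dist x y := by
    rw [dist_comm x y]
    exact profile_le hM0 hδ0 dist_nonneg hyx.le
  have hεd : 0 ≤ ε / 4 * dist x y' := by positivity
  have hint : dist y y' < R := by
    by_contra! hge
    have h1 := profile_ge (c := c) (ρ := R / 2) hM0 hδ0 (s := dist y y') dist_nonneg
    have h2 : 0 ≤ M * (dist y y' - δ / 2) := mul_nonneg hM0 (by linarith)
    have h3 : (R / 2) ^ 2 ≤ max (dist y y' - R / 2) 0 ^ 2 := by
      have := le_max_left (dist y y' - R / 2) 0
      gcongr
      linarith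
    have h4 : c * (R / 2) ^ 2 = (M + 2 * K + 1) * R := by
      rw [hc]
      field_simp
      ring
    have h5 : c * (R / 2) ^ 2 ≤ c * max (dist y y' - R / 2) 0 ^ 2 := by gcongr
    have h6 : M * dist x y ≤ M * (R / 2) := by gcongr
    nlinarith [hub y' hy'S]
  have hmax : IsLocalMax (fun z => u z - θ (dist y z) - ε / 4 * dist y' z) y' := by
    filter_upwards [Metric.isOpen_ball.mem_nhds (Metric.mem_ball'.2 hint)] with z hz
    rcases eq_or_ne z y' with rfl | hzy
    · exact le_rfl
    · rw [dist_self]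
      linarith [hy'2 z (Metric.ball_subset_closedBall hz) hzy]
  have htest := hu.2 _ hψ₁ _ (mul_dist_lipschitz (ε / 4) y' Ω) y' (hrΩ (hsub y' hy'S)) hmax
  rw [(radial_slopes hX hne hd continuous_profileDeriv (profileDeriv_zero hδ0 (by positivity))
    (profileDeriv_nonneg hM0 hδ0 hc0) y y').2] at htest
  have henv := slopeEnvelope_mul_dist_le hne (ε / 4) y' y'
  rw [abs_of_pos (by positivity)] at henv
  have hfy := (abs_lt.1 (hfr y' (hsub y' hy'S))).2
  have hclose : dist y y' < δ := by
    by_contra! hge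
    linarith [le_profileDeriv (M := M) (ρ := R / 2) hδ0 hc0 hge]
  have h1 := (le_abs_self _).trans (hKr y' (hsub y' hy'S) y
    (hsub y (Metric.mem_closedBall_self hR0.le)))
  have h2 : K * dist y' y ≤ K * δ := by
    rw [dist_comm]
    gcongr
  have h3 : 0 ≤ θ (dist y y') := profile_nonneg hM0 hδ0 hc0 _
  linarith

end Sub

/-! ### Supersolutions -/

section Super

variable {Ω : Set X} {f u : X → ℝ}

theorem IsMongeSupersolution.isSSupersolution (hΩ : IsOpen Ω) (hne : ∀ y : X, (𝓝[≠] y).NeBot)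
    (hu : IsMongeSupersolution Ω f u) : IsSSupersolution Ω f u := by
  refine ⟨hu.1.continuousOn.lowerSemicontinuousOn, fun ψ₁ hψ₁ ψ₂ hψ₂ x hx hmin => ?_⟩
  have henv := localSlope_le_slopeEnvelope hΩ hψ₂ hx hne
  have h0 : 0 ≤ localSlope ψ₂ x := localSlope_nonneg
  have h0' : 0 ≤ localSlope ψ₁ x := localSlope_nonneg
  by_contra! hlt
  set ε := (f x - slopeEnvelope ψ₂ x - localSlope ψ₁ x) / 4 with hε
  have hε0 : 0 < ε := by rw [hε]; linarith
  have h1 := eventually_of_localSlope_lt hΩ hψ₁.1 hx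
    (show localSlope ψ₁ x < localSlope ψ₁ x + ε by linarith)
  have h2 := eventually_of_localSlope_lt hΩ hψ₂ hx
    (show localSlope ψ₂ x < localSlope ψ₂ x + ε by linarith)
  have h3 := frequently_of_lt_subSlope (u := u) (x := x) (K := f x - ε)
    (by linarith) (by linarith [hu.2 x hx])
  obtain ⟨y, ⟨⟨e3, e1⟩, e2, e4⟩, e5⟩ :=
    ((h3.and_eventually (h1.filter_mono nhdsWithin_le_nhds)).and_eventually
      ((h2.filter_mono nhdsWithin_le_nhds).and (hmin.filter_mono nhdsWithin_le_nhds))).and_eventually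
      self_mem_nhdsWithin |>.exists
  have hd : 0 < dist x y := dist_pos.2 (Ne.symm e5)
  have e6 := neg_le_abs (ψ₁ y - ψ₁ x)
  have e7 := neg_le_abs (ψ₂ y - ψ₂ x)
  have : (f x - ε) * dist x y < (localSlope ψ₁ x + ε + (localSlope ψ₂ x + ε)) * dist x y := by
    linarith
  have := lt_of_mul_lt_mul_right this hd.le
  linarith

/-- A lower bound for the sub-slope follows from a descent at rate `m` at every small scale. -/
lemma le_subSlope_of_eventually_exists (hΩ : IsOpen Ω) (hu : LocallyLipschitzOn Ω u) {x : X}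
    (hx : x ∈ Ω) {m : ℝ} (hm : 0 < m)
    (h : ∀ᶠ r in 𝓝[>] (0 : ℝ), ∃ y, dist x y ≤ r ∧ m * r ≤ u x - u y) : m ≤ subSlope u x := by
  refine le_subSlope hΩ hu hx (frequently_iff.2 fun {U} hU => ?_)
  obtain ⟨δ, hδ, hball⟩ := Metric.mem_nhdsWithin_iff.1 hU
  obtain ⟨r, ⟨y, hy1, hy2⟩, hr⟩ := (h.and (Ioo_mem_nhdsGT hδ)).exists
  refine ⟨y, hball ⟨?_, ?_⟩, ?_⟩
  · rw [Metric.mem_ball']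
    exact hy1.trans_lt hr.2
  · rintro rfl
    have := mul_pos hm hr.1
    linarith
  · exact (mul_le_mul_of_nonneg_left hy1 hm.le).trans hy2

lemma le_subSlope_of_forall_lt {x : X} [(𝓝[≠] x).NeBot] {K : ℝ}
    (h : ∀ m, 0 < m → m < K → m ≤ subSlope u x) : K ≤ subSlope u x := by
  rcases le_or_gt K 0 with h0 | h0
  · exact h0.trans subSlope_nonneg
  · refine le_of_forall_lt fun m hm => ?_
    have h1 : max m 0 < K := max_lt hm h0
    refine lt_of_lt_of_le ?_ (h ((max m 0 + K) / 2) ?_ ?_) <;>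
      linarith [le_max_left m 0, le_max_right m 0]

/-- An s-supersolution is a Monge supersolution. Ekeland's principle on a small ball around `x`,
applied to `u` plus a radial profile of slope at most `m < f`, yields a point; it lies on the
sphere, since the test function would have too small a slope at an interior point. -/
theorem IsSSupersolution.isMongeSupersolution [CompleteSpace X] (hX : IsLengthSpace X)
    (hΩ : IsOpen Ω) (hne : ∀ y : X, (𝓝[≠] y).NeBot) (hf : ContinuousOn f Ω)
    (hlip : LocallyLipschitzOn Ω u) (hu : IsSSupersolution Ω f u) :
    IsMongeSupersolution Ω f u := by
  refine ⟨hlip, fun x hx => le_subSlope_of_forall_lt fun m hm hmf => ?_⟩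
  set η := (f x - m) / 4 with hη
  have hη0 : 0 < η := by rw [hη]; linarith
  set m' := m + η with hm'
  have hm'0 : 0 < m' := by positivity
  obtain ⟨r₀, K, hr₀, hK, hrΩ, hfr, hKr⟩ := exists_good_ball hΩ hf hlip hx hη0
  refine le_subSlope_of_eventually_exists hΩ hlip hx hm ?_
  filter_upwards [Ioo_mem_nhdsGT hr₀] with r hr
  have hr0 := hr.1
  have hsub : Metric.closedBall x r ⊆ Metric.ball x r₀ := Metric.closedBall_subset_ball hr.2
  set δ := η * r / m' with hδ
  have hδ0 : 0 < δ := by positivity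
  have hδm : m' * δ = η * r := by rw [hδ]; field_simp
  let θ := profile m' δ 0 r
  have hd := fun s => hasDerivAt_profile (δ := δ) m' 0 r s hδ0
  have hmem := radial_mem_lowerTestClass hX hne hd continuous_profileDeriv
    (profileDeriv_zero hδ0 hr0.le) (profileDeriv_nonneg hm'0.le hδ0 le_rfl) x Ω
  have hcu : ContinuousOn u (Metric.closedBall x r) :=
    hlip.continuousOn.mono fun z hz => hrΩ (hsub hz)
  have hcθ : Continuous fun z => θ (dist x z) :=
    (continuous_iff_continuousAt.2 fun s => (hd s).continuousAt).comp
      (continuous_const.dist continuous_id)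
  have hxS : x ∈ Metric.closedBall x r := Metric.mem_closedBall_self hr0.le
  have hlb : ∀ z ∈ Metric.closedBall x r, u x - u z ≤ K * r := fun z hz => by
    have h1 := (le_abs_self _).trans (hKr x (Metric.mem_ball_self hr₀) z (hsub hz))
    have h3 : K * dist x z ≤ K * r := by
      gcongr
      exact Metric.mem_closedBall'.1 hz
    linarith
  obtain ⟨y, hyS, hy1, hy2⟩ := exists_ekeland (Metric.isClosed_closedBall (x := x) (ε := r))
    (F := fun z => u z + θ (dist x z)) (hcu.add hcθ.continuousOn) (B := u x - K * r)
    (fun z hz => by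
      have : 0 ≤ θ (dist x z) := profile_nonneg hm'0.le hδ0 le_rfl _
      linarith [hlb z hz]) hη0 hxS
  have hyr : dist x y ≤ r := Metric.mem_closedBall'.1 hyS
  refine ⟨y, hyr, ?_⟩
  have hge : r ≤ dist x y := by
    by_contra! hint
    have hmin : IsLocalMin
        (fun z => u z - (-fun z => θ (dist x z)) z - -η * dist y z) y := by
      filter_upwards [Metric.isOpen_ball.mem_nhds (Metric.mem_ball'.2 hint)] with z hz
      simp only [Pi.neg_apply, dist_self]
      rcases eq_or_ne z y with rfl | hzy
      · simp
      · linarith [hy2 z (Metric.ball_subset_closedBall hz) hzy]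
    have htest := hu.2 _ (neg_mem_upperTestClass hmem) _ (mul_dist_lipschitz (-η) y Ω) y
      (hrΩ (hsub hyS)) hmin
    rw [localSlope_neg, (radial_slopes hX hne hd continuous_profileDeriv
      (profileDeriv_zero hδ0 hr0.le) (profileDeriv_nonneg hm'0.le hδ0 le_rfl) x y).2] at htest
    have henv := slopeEnvelope_mul_dist_le hne (-η) y y
    rw [abs_neg, abs_of_pos hη0] at henv
    have hfy := (abs_lt.1 (hfr y (hsub hyS))).1
    have := profileDeriv_le (c := 0) hm'0.le hδ0 hyr
    linarith
  have h1 := profile_ge (c := 0) (ρ := r) hm'0.le hδ0 (s := dist x y) dist_nonneg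
  have h2 : 0 ≤ η * dist x y := by positivity
  have h3 : θ (dist x x) = 0 := by
    rw [dist_self]
    exact profile_zero hδ0 hr0.le
  have h4 : m' * r ≤ m' * dist x y := by gcongr
  have h5 : m' * (dist x y - δ / 2) ≤ θ (dist x y) := by linarith
  have h6 : m' * r = m * r + η * r := by rw [hm']; ring
  have h7 : 0 < η * r := by positivity
  linarith

lemma le_exitTime {Y : Type*} {Ω : Set Y} {γ : ℝ → Y} (hγ : LeavesInFiniteTime Ω γ) {r : ℝ}
    (h : ∀ t, 0 ≤ t → t < r → γ t ∈ Ω) : r ≤ exitTime Ω γ := by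
  obtain ⟨⟨t, ht⟩, -⟩ := hγ
  refine le_csInf ⟨t, ht⟩ fun s hs => ?_
  by_contra! hlt
  exact hs.2 (h s hs.1 hlt)

lemma entranceTime_le {Y : Type*} {Ω : Set Y} {γ : ℝ → Y} (hγ : LeavesInFiniteTime Ω γ) {r : ℝ}
    (h : ∀ t, t ≤ 0 → -r < t → γ t ∈ Ω) : entranceTime Ω γ ≤ -r := by
  obtain ⟨-, ⟨t, ht⟩⟩ := hγ
  refine csSup_le ⟨t, ht⟩ fun s hs => ?_
  by_contra! hlt
  exact hs.2 (h s hs.1 hlt)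

/-- In dimension one, a function with test slopes from below larger than `m` descends at rate
almost `m` from `0` to one of the end points of an interval. -/
lemma exists_endpoint_descent {w : ℝ → ℝ} {r m δ : ℝ} (hr : 0 < r) (hm : 0 < m) (hδ : 0 < δ)
    (hw : LowerSemicontinuousOn w (Icc (-r) r))
    (h : ∀ φ : ℝ → ℝ, ContDiff ℝ 1 φ → ∀ t ∈ Ioo (-r) r, IsLocalMin (fun s => w s - φ s) t →
      m < |deriv φ t|) :
    ∃ t, |t| = r ∧ w t ≤ w 0 - m * (r - δ / 2) := by
  let P := profile m δ 0 r
  let φ : ℝ → ℝ := fun t => -(P t + P (-t))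
  have hd : ∀ t, HasDerivAt φ (-(profileDeriv m δ 0 r t - profileDeriv m δ 0 r (-t))) t := fun t => by
    have h1 := hasDerivAt_profile m 0 r t hδ
    have h2 := (hasDerivAt_profile m 0 r (-t) hδ).comp t (hasDerivAt_neg t)
    refine (h1.add h2).neg.congr_deriv ?_
    ring
  have hφ : ContDiff ℝ 1 φ := by
    rw [contDiff_one_iff_deriv]
    refine ⟨fun t => (hd t).differentiableAt, ?_⟩
    rw [show deriv φ = _ from funext fun t => (hd t).deriv]
    exact (continuous_profileDeriv.sub (continuous_profileDeriv.comp continuous_neg)).neg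
  have hlsc : LowerSemicontinuousOn (fun t => w t + -φ t) (Icc (-r) r) :=
    hw.add hφ.continuous.neg.continuousOn.lowerSemicontinuousOn
  obtain ⟨t, ht, hmin⟩ := hlsc.exists_isMinOn ⟨0, by constructor <;> linarith⟩ isCompact_Icc
  have h0 := hmin (show (0 : ℝ) ∈ Icc (-r) r by constructor <;> linarith)
  simp only [mem_ofPred_eq, φ, P, neg_zero, profile_zero hδ hr.le] at h0
  have habs : |t| = r := by
    by_contra hne
    have htI : t ∈ Ioo (-r) r := abs_lt.1 (lt_of_le_of_ne (abs_le.2 ht) hne)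
    have hloc := hmin.isLocalMin (Icc_mem_nhds htI.1 htI.2)
    have := h φ hφ t htI (by simpa only [← sub_eq_add_neg] using hloc)
    rw [(hd t).deriv, abs_neg] at this
    have a1 := profileDeriv_nonneg (ρ := r) hm.le hδ le_rfl t
    have a2 := profileDeriv_nonneg (ρ := r) hm.le hδ le_rfl (-t)
    have a3 := profileDeriv_le (c := 0) hm.le hδ ht.2
    have a4 := profileDeriv_le (c := 0) hm.le hδ (show -t ≤ r by linarith [ht.1])
    exact absurd this (not_lt.2 (abs_le.2 ⟨by linarith, by linarith⟩))
  refine ⟨t, habs, ?_⟩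
  have hsum : profile m δ 0 r |t| ≤ profile m δ 0 r t + profile m δ 0 r (-t) := by
    have b1 := profile_nonneg (ρ := r) hm.le hδ le_rfl t
    have b2 := profile_nonneg (ρ := r) hm.le hδ le_rfl (-t)
    rcases abs_choice t with e | e <;> rw [e] <;> linarith
  have := profile_ge (c := 0) (ρ := r) hm.le hδ (abs_nonneg t)
  rw [habs] at this hsum
  linarith

/-- A c-supersolution is a Monge supersolution: by the one-dimensional descent lemma the almost
optimal curve through `x` leads, in one of its two directions, to points where `u` is lower at a
rate close to `f x`. -/
theorem IsCSupersolution.isMongeSupersolution (hΩ : IsOpen Ω) (hne : ∀ y : X, (𝓝[≠] y).NeBot)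
    (hf : ContinuousOn f Ω) (hlip : LocallyLipschitzOn Ω u) (hu : IsCSupersolution Ω f u) :
    IsMongeSupersolution Ω f u := by
  refine ⟨hlip, fun x hx => le_subSlope_of_forall_lt fun m hm hmf => ?_⟩
  set η := (f x - m) / 4 with hη
  have hη0 : 0 < η := by rw [hη]; linarith
  set m' := m + η with hm'
  have hm'0 : 0 < m' := by positivity
  obtain ⟨r₀, K, hr₀, hK, hrΩ, hfr, hKr⟩ := exists_good_ball hΩ hf hlip hx hη0
  refine le_subSlope_of_eventually_exists hΩ hlip hx hm ?_
  filter_upwards [Ioo_mem_nhdsGT hr₀] with r hr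
  have hr0 := hr.1
  obtain ⟨γ, w, hγ, hleave, hlsc, hw0, hwu, htest⟩ :=
    hu.2 (min η (η * r / 2)) (by positivity) x hx
  have hdist : ∀ t, dist x (γ t) ≤ |t| := fun t => by
    have := unitSpeed_dist_le hγ.1 (mem_univ 0) (mem_univ t)
    rwa [hγ.2.2, zero_sub, abs_neg] at this
  have hin : ∀ t, |t| < r₀ → γ t ∈ Metric.ball x r₀ := fun t ht =>
    Metric.mem_ball'.2 ((hdist t).trans_lt ht)
  have hexit := le_exitTime hleave (r := r₀) fun t h1 h2 =>
    hrΩ (hin t (by rwa [abs_of_nonneg h1]))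
  have hentr := entranceTime_le hleave (r := r₀) fun t h1 h2 =>
    hrΩ (hin t (by rw [abs_of_nonpos h1]; linarith))
  have hsub : Icc (-r) r ⊆ Ioo (entranceTime Ω γ) (exitTime Ω γ) := fun t ht =>
    ⟨by linarith [ht.1, hr.2], by linarith [ht.2, hr.2]⟩
  obtain ⟨t, ht, hwt⟩ := exists_endpoint_descent hr0 hm'0 (δ := η * r / m') (by positivity)
    (hlsc.mono hsub) fun φ hφ t ht hmin => by
      have h1 := htest φ hφ t (hsub (Ioo_subset_Icc_self ht)) hmin
      have h2 := (abs_lt.1 (hfr _ (hin t ((abs_lt.2 ht).trans hr.2)))).1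
      have h3 := min_le_left η (η * r / 2)
      linarith
  refine ⟨γ t, ht ▸ hdist t, ?_⟩
  have h1 := hwu t (hsub (abs_le.1 ht.le))
  have h2 := min_le_right η (η * r / 2)
  have h3 : m' * (r - η * r / m' / 2) = m' * r - η * r / 2 := by field_simp
  rw [h3, hw0] at hwt
  have h4 : m' * r = m * r + η * r := by rw [hm']; ring
  linarith

/-- A Monge supersolution descends at rate `m < f` from the centre of a ball to its boundary: the
point provided by Ekeland's principle on the ball cannot be interior. -/
lemma IsMongeSupersolution.exists_descent [CompleteSpace X]
    (hne : ∀ y : X, (𝓝[≠] y).NeBot) (hu : IsMongeSupersolution Ω f u) {y : X} {h m B : ℝ}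
    (hh : 0 ≤ h) (hm : 0 < m) (hball : Metric.closedBall y h ⊆ Ω)
    (hB : ∀ z ∈ Ω, B ≤ u z) (hf : ∀ z ∈ Metric.closedBall y h, m < f z) :
    ∃ z, dist y z = h ∧ u z ≤ u y - m * h := by
  obtain ⟨z, hz, hz1, hz2⟩ := exists_ekeland (Metric.isClosed_closedBall (x := y) (ε := h))
    (hu.1.continuousOn.mono hball) (fun z hz => hB z (hball hz)) hm
    (Metric.mem_closedBall_self hh)
  have hzh : dist y z ≤ h := Metric.mem_closedBall'.1 hz
  have hge : h ≤ dist y z := by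
    by_contra! hlt
    have hev : ∀ᶠ z' in 𝓝 z, u z - u z' ≤ m * dist z z' := by
      filter_upwards [Metric.isOpen_ball.mem_nhds (Metric.mem_ball'.2 hlt)] with z' hz'
      rcases eq_or_ne z' z with rfl | hzz
      · simp
      · linarith [hz2 z' (Metric.ball_subset_closedBall hz') hzz]
    have : subSlope u z ≤ m := subSlope_le hm.le fun ε hε => hev.mono fun z' hz' => by
      have : 0 ≤ ε * dist z z' := by positivity
      linarith
    linarith [hu.2 z (hball hz), hf z hz]
  have heq := le_antisymm hzh hge
  exact ⟨z, heq, by rw [heq] at hz1; linarith⟩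

end Super

/-! ### Descent paths -/

section Path

variable {Ω : Set X} {f u : X → ℝ} {ε : ℝ}

/-- A unit speed curve `γ` from `y` that stays in `Ω` up to its end point, which is outside `Ω`,
together with a function `W` of time that starts from `u y`, is almost above `u` along `γ`, and
descends at every time at rate at least `f ∘ γ - ε`. The function `W` may jump downwards. -/
def HasDescentPath (Ω : Set X) (f u : X → ℝ) (ε : ℝ) (y : X) : Prop :=
  ∃ (T : ℝ) (γ : ℝ → X) (W : ℝ → ℝ), 0 < T ∧ HasUnitSpeedOn γ (Icc 0 T) ∧ γ 0 = y ∧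
    (∀ t ∈ Ico 0 T, γ t ∈ Ω) ∧ γ T ∉ Ω ∧ LowerSemicontinuousOn W (Ico 0 T) ∧ W 0 = u y ∧
    (∀ t ∈ Ico 0 T, u (γ t) - ε ≤ W t) ∧
    ∀ t ∈ Ico 0 T, ∀ᶠ s in 𝓝[>] t, W s ≤ W t - (f (γ t) - ε) * (s - t)

/-- A short curve that leaves `Ω`, with `W` affine, is a descent path. -/
lemma HasDescentPath.of_exit {y : X} {T m : ℝ} {γ : ℝ → X} (hT : 0 < T)
    (hγ : HasUnitSpeedOn γ (Icc 0 T)) (h0 : γ 0 = y) (hΩ : ∀ t ∈ Ico 0 T, γ t ∈ Ω)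
    (hexit : γ T ∉ Ω) (hf : ∀ t ∈ Ico 0 T, f (γ t) - ε ≤ m)
    (hu : ∀ t ∈ Ico 0 T, u (γ t) - ε ≤ u y - m * t) : HasDescentPath Ω f u ε y := by
  refine ⟨T, γ, fun t => u y - m * t, hT, hγ, h0, hΩ, hexit, ?_, by simp, hu, fun t ht => ?_⟩
  · exact Continuous.lowerSemicontinuous (by fun_prop) |>.lowerSemicontinuousOn _
  · filter_upwards [self_mem_nhdsWithin] with s hs
    have : (f (γ t) - ε) * (s - t) ≤ m * (s - t) :=
      mul_le_mul_of_nonneg_right (hf t ht) (sub_nonneg.2 (le_of_lt hs))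
    linarith

/-- A curve in `Ω` from `y` to `z`, along which the affine function of slope `-m` serves as `W`, can
be put in front of a descent path from `z`. -/
lemma HasDescentPath.prepend {y z : X} {l m : ℝ} {σ : ℝ → X} (hl : 0 < l) (hm : 0 ≤ m)
    (hσ : HasUnitSpeedOn σ (Icc 0 l)) (h0 : σ 0 = y) (hl' : σ l = z)
    (hΩ : ∀ t ∈ Icc 0 l, σ t ∈ Ω) (hf : ∀ t ∈ Icc 0 l, f (σ t) - ε ≤ m)
    (hu : ∀ t ∈ Icc 0 l, u (σ t) - ε ≤ u y - m * t) (hz : u z ≤ u y - m * l)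
    (h : HasDescentPath Ω f u ε z) : HasDescentPath Ω f u ε y := by
  obtain ⟨T, γ, W, hT, hγ, hγ0, hγΩ, hγT, hW, hW0, hWu, hWd⟩ := h
  have hshift : ∀ t, t ∈ Ico 0 (T + l) → l ≤ t → t - l ∈ Ico 0 T := fun t ht hlt =>
    ⟨by linarith, by linarith [ht.2]⟩
  refine ⟨T + l, fun t => if t < l then σ t else γ (t - l),
    fun t => if t < l then u y - m * t else W (t - l), by positivity,
    unitSpeed_concat hσ hγ (hl'.trans hγ0.symm), by simp [hl, h0], fun t ht => ?_, ?_,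
    fun t ht a ha => ?_, by simp [hl], fun t ht => ?_, fun t ht => ?_⟩
  · dsimp only
    split_ifs with hlt
    · exact hΩ t ⟨ht.1, hlt.le⟩
    · exact hγΩ _ (hshift t ht (not_lt.1 hlt))
  · beta_reduce
    rw [if_neg (by linarith), add_sub_cancel_right]
    exact hγT
  · beta_reduce at ha ⊢
    by_cases hlt : t < l
    · rw [if_pos hlt] at ha
      have hc : Continuous fun s : ℝ => u y - m * s := by fun_prop
      filter_upwards [nhdsWithin_le_nhds (Iio_mem_nhds hlt),
        nhdsWithin_le_nhds ((hc.tendsto t).eventually (lt_mem_nhds ha))] with s hs1 hs2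
      rw [if_pos (show s < l from hs1)]
      exact hs2
    · rw [if_neg hlt] at ha
      rw [not_lt] at hlt
      have hc : Tendsto (fun s : ℝ => s - l) (𝓝 t) (𝓝 (t - l)) :=
        (continuous_id.sub continuous_const).tendsto t
      have h1 := hc.eventually (eventually_nhdsWithin_iff.1 (hW _ (hshift t ht hlt) a ha))
      -- before the junction time the first piece is above the starting value of the second one
      have h2 : ∀ᶠ s in 𝓝 t, s < l → a < u y - m * s := by
        rcases hlt.eq_or_lt with rfl | hlt
        · refine Eventually.of_forall fun s hs => ?_
          rw [sub_self, hW0] at ha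
          have : m * s ≤ m * l := by gcongr
          linarith
        · filter_upwards [Ioi_mem_nhds hlt] with s hs hs'
          exact absurd hs' (not_lt.2 (le_of_lt hs))
      filter_upwards [nhdsWithin_le_nhds h1, nhdsWithin_le_nhds h2, self_mem_nhdsWithin] with
        s e1 e2 hs
      split_ifs with hsl
      · exact e2 hsl
      · exact e1 (hshift s hs (not_lt.1 hsl))
  · dsimp only
    split_ifs with hlt
    · exact hu t ⟨ht.1, hlt.le⟩
    · exact hWu _ (hshift t ht (not_lt.1 hlt))
  · by_cases hlt : t < l
    · filter_upwards [self_mem_nhdsWithin, nhdsWithin_le_nhds (Iio_mem_nhds hlt)] with s hs hsl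
      rw [if_pos (show s < l from hsl), if_pos hlt, if_pos hlt]
      have : (f (σ t) - ε) * (s - t) ≤ m * (s - t) :=
        mul_le_mul_of_nonneg_right (hf t ⟨ht.1, hlt.le⟩) (sub_nonneg.2 (le_of_lt hs))
      linarith
    · have hc : Tendsto (fun s : ℝ => s - l) (𝓝[>] t) (𝓝[>] (t - l)) := by
        refine tendsto_nhdsWithin_iff.2 ⟨((continuous_id.sub continuous_const).tendsto t).mono_left
          nhdsWithin_le_nhds, ?_⟩
        filter_upwards [self_mem_nhdsWithin] with s hs
        exact sub_lt_sub_right hs l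
      filter_upwards [hc.eventually (hWd _ (hshift t ht (not_lt.1 hlt))), self_mem_nhdsWithin] with
        s e1 hs
      rw [if_neg (not_lt.2 ((not_lt.1 hlt).trans (le_of_lt hs))), if_neg hlt, if_neg hlt]
      rwa [sub_sub_sub_cancel_right] at e1

lemma HasDerivAt.le_of_eventually_right {φ : ℝ → ℝ} {a t K : ℝ} (hφ : HasDerivAt φ a t)
    (h : ∀ᶠ s in 𝓝[>] t, φ s - φ t ≤ K * (s - t)) : a ≤ K := by
  have h1 := (hasDerivWithinAt_iff_tendsto_slope' (notMem_Ioi.2 le_rfl)).1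
    (hφ.hasDerivWithinAt (s := Ioi t))
  refine le_of_tendsto h1 ?_
  filter_upwards [h, self_mem_nhdsWithin] with s hs hst
  rw [slope_def_field, div_le_iff₀ (sub_pos.2 hst)]
  exact hs

/-- The even extension of a descent path, run back and forth, is an admissible curve for the
definition of c-supersolutions. -/
lemma HasDescentPath.exists_curve {x : X} (h : HasDescentPath Ω f u ε x) :
    ∃ (γ : ℝ → X) (w : ℝ → ℝ), IsAdmissibleCurve univ x γ ∧ LeavesInFiniteTime Ω γ ∧
      LowerSemicontinuousOn w (Ioo (entranceTime Ω γ) (exitTime Ω γ)) ∧ w 0 = u x ∧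
      (∀ t ∈ Ioo (entranceTime Ω γ) (exitTime Ω γ), u (γ t) - ε ≤ w t) ∧
      ∀ φ : ℝ → ℝ, ContDiff ℝ 1 φ → ∀ t₀ ∈ Ioo (entranceTime Ω γ) (exitTime Ω γ),
        IsLocalMin (fun t => w t - φ t) t₀ → f (γ t₀) - ε ≤ |deriv φ t₀| := by
  obtain ⟨T, γ, W, hT, hγ, hγ0, hγΩ, hγT, hW, hW0, hWu, hWd⟩ := h
  have hT' : fold T T = T := fold_of_mem hT (right_mem_Icc.2 hT.le)
  have habs : ∀ t, |t| < T → fold T t = |t| := fun t ht => by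
    have h1 : fold T |t| = fold T t := by
      rcases abs_choice t with e | e <;> rw [e]
      exact fold_neg T t
    rw [← h1, fold_of_mem hT ⟨abs_nonneg t, ht.le⟩]
  have hin : ∀ t, |t| < T → γ (fold T t) ∈ Ω := fun t ht => by
    rw [habs t ht]
    exact hγΩ _ ⟨abs_nonneg t, ht⟩
  have hleave : LeavesInFiniteTime Ω fun t => γ (fold T t) :=
    ⟨⟨T, hT.le, by beta_reduce; rwa [hT']⟩, ⟨-T, by linarith, by beta_reduce; rwa [fold_neg, hT']⟩⟩
  have hexit : exitTime Ω (fun t => γ (fold T t)) = T := by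
    refine le_antisymm (csInf_le ⟨0, fun t ht => ht.1⟩ ⟨hT.le, by beta_reduce; rwa [hT']⟩) ?_
    exact le_exitTime hleave fun t h1 h2 => hin t (by rwa [abs_of_nonneg h1])
  have hentr : entranceTime Ω (fun t => γ (fold T t)) = -T := by
    refine le_antisymm ?_ (le_csSup ⟨0, fun t ht => ht.1⟩
      ⟨by linarith, by beta_reduce; rwa [fold_neg, hT']⟩)
    exact entranceTime_le hleave fun t h1 h2 => hin t (by rw [abs_of_nonpos h1]; linarith)
  refine ⟨fun t => γ (fold T t), fun t => W |t|,
    ⟨unitSpeed_comp_fold hT hγ, fun _ => mem_univ _, ?_⟩, hleave, ?_, ?_, ?_, ?_⟩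
  · beta_reduce
    rw [habs 0 (by rwa [abs_zero]), abs_zero, hγ0]
  · rw [hexit, hentr]
    exact hW.comp continuous_abs.continuousOn fun t ht => ⟨abs_nonneg t, abs_lt.2 ht⟩
  · beta_reduce
    rw [abs_zero, hW0]
  · rw [hexit, hentr]
    intro t ht
    beta_reduce
    rw [habs t (abs_lt.2 ht)]
    exact hWu _ ⟨abs_nonneg t, abs_lt.2 ht⟩
  · rw [hexit, hentr]
    -- the case of nonnegative times; the other one follows by symmetry
    have key : ∀ φ : ℝ → ℝ, ContDiff ℝ 1 φ → ∀ t, 0 ≤ t → t < T →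
        IsLocalMin (fun t => W |t| - φ t) t → f (γ t) - ε ≤ |deriv φ t| := by
      intro φ hφ t h0 htT hmin
      have hd : HasDerivAt φ (deriv φ t) t := (hφ.differentiable one_ne_zero t).hasDerivAt
      have h1 : deriv φ t ≤ -(f (γ t) - ε) := by
        refine HasDerivAt.le_of_eventually_right hd ?_
        filter_upwards [hWd t ⟨h0, htT⟩, nhdsWithin_le_nhds hmin, self_mem_nhdsWithin] with
          s e1 e2 hs
        rw [abs_of_nonneg h0, abs_of_nonneg (h0.trans (le_of_lt hs))] at e2
        linarith
      linarith [neg_le_abs (deriv φ t)]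
    intro φ hφ t ht hmin
    beta_reduce
    rw [habs t (abs_lt.2 ht)]
    rcases le_total 0 t with h0 | h0
    · rw [abs_of_nonneg h0]
      exact key φ hφ t h0 ht.2 hmin
    · rw [abs_of_nonpos h0]
      have := key (fun s => φ (-s)) (hφ.comp contDiff_neg) (-t) (by linarith) (by linarith [ht.1]) ?_
      · rwa [deriv_comp_neg, neg_neg, abs_neg] at this
      · have hneg : Tendsto (fun s : ℝ => -s) (𝓝 (-t)) (𝓝 t) := by
          simpa using (continuous_neg (G := ℝ)).tendsto (-t)
        filter_upwards [hneg.eventually hmin] with s hs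
        simpa using hs

lemma unitSpeed_mono {γ : ℝ → X} {a b c : ℝ} (h : HasUnitSpeedOn γ (Icc a b)) (hc : c ≤ b) :
    HasUnitSpeedOn γ (Icc a c) := by
  rw [hasUnitSpeedOn_Icc_iff] at h ⊢
  exact fun s t h1 h2 h3 => h s t h1 h2 (h3.trans hc)

/-- From every point of `Ω` there is a descent path of a Monge solution that is bounded below. It
is a concatenation of steps which decrease `u` by at least a fixed amount, so that finitely many
steps lead to the boundary. -/
theorem exists_hasDescentPath [CompleteSpace X] (hX : IsLengthSpace X) (hΩ : IsOpen Ω)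
    (hne : ∀ y : X, (𝓝[≠] y).NeBot) (hf : UniformContinuousOn f Ω) {c : ℝ} (hc : 0 < c)
    (hcf : ∀ x ∈ Ω, c ≤ f x) (hu : IsMongeSolution Ω f u) {B : ℝ} (hB : ∀ x ∈ Ω, B ≤ u x)
    (hε : 0 < ε) (hε1 : ε ≤ 1) (hεc : ε ≤ c) : ∀ x ∈ Ω, HasDescentPath Ω f u ε x := by
  obtain ⟨δ, hδ, hfδ⟩ := Metric.uniformContinuousOn_iff.1 hf (ε / 8) (by positivity)
  -- the uniform decrease of `u` in one step
  set κ := min (c * δ / 8) (ε * c / (16 * (c + 1))) with hκ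
  have hκ0 : 0 < κ := by positivity
  have main : ∀ n : ℕ, ∀ y ∈ Ω, u y < B + n * κ → HasDescentPath Ω f u ε y := by
    intro n
    induction n with
    | zero =>
      intro y hy hlt
      simp only [Nat.cast_zero, zero_mul, add_zero] at hlt
      exact absurd (hB y hy) (not_le.2 hlt)
    | succ n ih =>
      intro y hy hlt
      have hfy := hcf y hy
      have hfy0 : 0 < f y := hc.trans_le hfy
      set h := min (δ / 4) (ε / (8 * (f y + 1))) with hh
      have hh0 : 0 < h := by positivity
      have hhδ : h ≤ δ / 4 := min_le_left _ _
      have hhε : h * (8 * (f y + 1)) ≤ ε :=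
        (le_div_iff₀ (by positivity)).1 (min_le_right (δ / 4) (ε / (8 * (f y + 1))))
      have hosc : ∀ z ∈ Ω, dist y z < δ → |f z - f y| < ε / 8 := fun z hz hd => by
        have := hfδ z hz y hy (by rwa [dist_comm])
        rwa [Real.dist_eq] at this
      have hm0 : 0 ≤ f y - ε / 2 := by linarith
      -- estimates along a short curve from `y`
      have hshort : ∀ (σ : ℝ → X) (L : ℝ), 0 ≤ L → L ≤ 3 * h → HasUnitSpeedOn σ (Icc 0 L) →
          σ 0 = y → (∀ t ∈ Icc 0 L, σ t ∈ Ω) →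
          f (σ L) - ε ≤ f y - ε / 2 ∧ u (σ L) - ε ≤ u y - (f y - ε / 2) * L := by
        intro σ L hL hLh hσ h0 hσΩ
        have hfσ : ∀ t ∈ Icc 0 L, |f (σ t) - f y| < ε / 8 := fun t ht => by
          refine hosc _ (hσΩ t ht) ?_
          have := unitSpeed_dist_le hσ (left_mem_Icc.2 hL) ht
          rw [h0, zero_sub, abs_neg, abs_of_nonneg ht.1] at this
          linarith [ht.2]
        have h1 := hu.1.sub_le_of_unitSpeed' hΩ hL (M := f y + ε / 8) (by positivity) hσ hσΩ
          fun t ht => by linarith [(abs_lt.1 (hfσ t ht)).2]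
        have h2 := (abs_lt.1 (hfσ L (right_mem_Icc.2 hL))).2
        refine ⟨by linarith, ?_⟩
        rw [h0] at h1
        have h3 : (2 * f y) * L ≤ (2 * f y) * (3 * h) := by gcongr
        have h4 : 0 ≤ ε * L := by positivity
        nlinarith
      by_cases hball : Metric.closedBall y (2 * h) ⊆ Ω
      · have hsub : Metric.closedBall y h ⊆ Ω :=
          (Metric.closedBall_subset_closedBall (by linarith)).trans hball
        obtain ⟨z, hz1, hz2⟩ := hu.2.exists_descent hne hh0.le
          (show 0 < f y - ε / 4 by linarith) hsub hB fun z hz => by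
            have := (abs_lt.1 (hosc z (hsub hz) (by
              linarith [Metric.mem_closedBall'.1 hz]))).1
            linarith
        have hzΩ : z ∈ Ω := hsub (Metric.mem_closedBall'.2 hz1.le)
        set η := h * ε / (4 * (f y + 1)) with hη
        have hη0 : 0 < η := by positivity
        have hη1 : η * (4 * (f y + 1)) = h * ε := by rw [hη]; field_simp
        have hηh : η ≤ h := by nlinarith
        obtain ⟨l, σ, hl1, hl2, hσ, hσ0, hσl⟩ := hX.exists_unitSpeed y z hη0
        rw [hz1] at hl1 hl2
        have hl0 : 0 < l := hh0.trans_le hl1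
        have hσΩ : ∀ t ∈ Icc 0 l, σ t ∈ Ω := fun t ht => by
          refine hball (Metric.mem_closedBall'.2 ?_)
          have := unitSpeed_dist_le hσ (left_mem_Icc.2 hl0.le) ht
          rw [hσ0, zero_sub, abs_neg, abs_of_nonneg ht.1] at this
          linarith [ht.2]
        have hest := fun t (ht : t ∈ Icc 0 l) => hshort σ t ht.1 (by linarith [ht.2])
          (unitSpeed_mono hσ ht.2) hσ0 fun s hs => hσΩ s ⟨hs.1, hs.2.trans ht.2⟩
        refine HasDescentPath.prepend hl0 hm0 hσ hσ0 hσl hσΩ (fun t ht => (hest t ht).1)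
          (fun t ht => (hest t ht).2) ?_ (ih z hzΩ ?_)
        · have h1 : (f y - ε / 2) * l ≤ (f y - ε / 2) * (h + η) := by gcongr
          have h2 : 0 ≤ ε * η := by positivity
          nlinarith
        · have hdec : κ ≤ (f y - ε / 4) * h := by
            have h1 : f y / 2 * h ≤ (f y - ε / 4) * h := by
              gcongr
              linarith
            refine le_trans ?_ h1
            rcases min_choice (δ / 4) (ε / (8 * (f y + 1))) with e | e
            · rw [hh, e]
              refine (min_le_left _ _).trans ?_
              nlinarith
            · rw [hh, e]
              refine (min_le_right _ _).trans ?_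
              rw [div_mul_div_comm, div_le_div_iff₀ (by positivity) (by positivity)]
              nlinarith
          push_cast at hlt
          linarith
      · obtain ⟨z, hz, hzΩ⟩ := not_subset.1 hball
        rw [Metric.mem_closedBall'] at hz
        obtain ⟨L, γ, hL1, hL2, hγ, hγ0, hγL⟩ := hX.exists_unitSpeed y z hh0
        have hL0 : 0 ≤ L := dist_nonneg.trans hL1
        have hcl : IsClosed (Icc 0 L ∩ γ ⁻¹' Ωᶜ) :=
          (unitSpeed_continuousOn hγ).preimage_isClosed_of_isClosed isClosed_Icc hΩ.isClosed_compl
        obtain ⟨T, hT, hTmin⟩ :=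
          (isCompact_Icc.of_isClosed_subset hcl inter_subset_left).exists_isLeast
          ⟨L, right_mem_Icc.2 hL0, by rw [mem_preimage, hγL]; exact hzΩ⟩
        have hT0 : 0 < T := by
          refine lt_of_le_of_ne hT.1.1 ?_
          rintro rfl
          exact hT.2 (by rwa [hγ0])
        have hγΩ : ∀ t ∈ Ico 0 T, γ t ∈ Ω := fun t ht => by
          by_contra hcon
          exact absurd (hTmin ⟨⟨ht.1, ht.2.le.trans hT.1.2⟩, hcon⟩) (not_le.2 ht.2)
        have hest := fun t (ht : t ∈ Ico 0 T) => hshort γ t ht.1 (by linarith [ht.2, hT.1.2])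
          (unitSpeed_mono hγ (ht.2.le.trans hT.1.2)) hγ0
          fun s hs => hγΩ s ⟨hs.1, hs.2.trans_lt ht.2⟩
        exact HasDescentPath.of_exit hT0 (unitSpeed_mono hγ hT.1.2) hγ0 hγΩ hT.2
          (fun t ht => (hest t ht).1) (fun t ht => (hest t ht).2)
  intro x hx
  obtain ⟨n, hn⟩ := exists_nat_gt ((u x - B) / κ)
  rw [div_lt_iff₀ hκ0] at hn
  exact main n x hx (by linarith)

theorem IsMongeSolution.isCSupersolution [CompleteSpace X] (hX : IsLengthSpace X) (hΩ : IsOpen Ω)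
    (hne : ∀ y : X, (𝓝[≠] y).NeBot) (hf : UniformContinuousOn f Ω) {c : ℝ} (hc : 0 < c)
    (hcf : ∀ x ∈ Ω, c ≤ f x) (hu : IsMongeSolution Ω f u) {B : ℝ} (hB : ∀ x ∈ Ω, B ≤ u x) :
    IsCSupersolution Ω f u := by
  refine ⟨hu.1.1.continuousOn.lowerSemicontinuousOn, fun ε hε x hx => ?_⟩
  -- the requirements weaken as `ε` grows
  set ε' := min ε (min 1 c) with hε'
  have hε'ε : ε' ≤ ε := min_le_left _ _
  obtain ⟨γ, w, h1, h2, h3, h4, h5, h6⟩ := (exists_hasDescentPath hX hΩ hne hf hc hcf hu hB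
    (ε := ε') (by positivity) ((min_le_right _ _).trans (min_le_left _ _))
    ((min_le_right _ _).trans (min_le_right _ _)) x hx).exists_curve
  exact ⟨γ, w, h1, h2, h3, h4, fun t ht => by linarith [h5 t ht],
    fun φ hφ t ht hmin => by linarith [h6 φ hφ t ht hmin]⟩

end Path

/-! ### Comparison -/

section Comparison

variable {Ω : Set X} {f g u v : X → ℝ}

/-- A function with boundary values in the uniform sense is bounded on a bounded domain. -/
lemma SatisfiesBoundaryCondition.exists_abs_le (hΩ : Bornology.IsBounded Ω)
    (hfr : (frontier Ω).Nonempty) (hu : SatisfiesBoundaryCondition Ω g u) :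
    ∃ B, 0 ≤ B ∧ ∀ x ∈ Ω, |u x| ≤ B := by
  obtain ⟨y, hy⟩ := hfr
  obtain ⟨ω, hω, h⟩ := hu
  obtain ⟨R, hR⟩ := hΩ.subset_closedBall y
  refine ⟨max (|g y| + ω R) 0, le_max_right _ _, fun x hx => le_max_of_le_left ?_⟩
  have hxy : dist x y ≤ R := Metric.mem_closedBall.1 (hR hx)
  have h1 := h x hx y hy
  have h2 := hω.2.1 (mem_Ici.2 dist_nonneg) (mem_Ici.2 (dist_nonneg.trans hxy)) hxy
  linarith [abs_sub_abs_le_abs_sub (u x) (g y)]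

/-- Two functions with the same boundary values are uniformly close near the boundary. -/
lemma exists_close_near_frontier (hX : IsLengthSpace X) (hΩ : IsOpen Ω)
    (hu : SatisfiesBoundaryCondition Ω g u) (hv : SatisfiesBoundaryCondition Ω g v) {a : ℝ}
    (ha : 0 < a) : ∃ η > 0, ∀ x ∈ Ω, ∀ z ∉ Ω, dist x z < η → u x - v x ≤ a := by
  obtain ⟨ω, hω, h⟩ := hu
  obtain ⟨ω', hω', h'⟩ := hv
  have key : ∀ ω : ℝ → ℝ, IsModulus ω → ∀ᶠ s in 𝓝[Ici 0] (0 : ℝ), ω s < a / 2 := fun ω hω => by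
    have := hω.1 0 (mem_Ici.2 le_rfl)
    rw [ContinuousWithinAt, hω.2.2] at this
    exact this.eventually (gt_mem_nhds (half_pos ha))
  obtain ⟨η, hη, hball⟩ := Metric.mem_nhdsWithin_iff.1 ((key ω hω).and (key ω' hω'))
  refine ⟨η, hη, fun x hx z hz hxz => ?_⟩
  obtain ⟨y, hy, hxy⟩ := hX.exists_frontier hΩ hx hz (half_pos (sub_pos.2 hxz))
  obtain ⟨e1, e2⟩ := hball (show dist x y ∈ Metric.ball 0 η ∩ Ici 0 from
    ⟨by rw [Metric.mem_ball, Real.dist_0_eq_abs, abs_of_nonneg dist_nonneg]; linarith,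
      mem_Ici.2 dist_nonneg⟩)
  have h1 := (abs_le.1 (h x hx y hy)).2
  have h2 := (abs_le.1 (h' x hx y hy)).1
  linarith

/-- The comparison principle. If `v - u` were negative somewhere, then so would be `v - λ u` for
some `λ < 1`, well below its values near the boundary. Ekeland's principle would give an interior
point at which the sub-slope of `v` is at most about `λ f`. -/
theorem le_of_mongeSubsolution_of_mongeSupersolution [CompleteSpace X] (hX : IsLengthSpace X)
    (hΩ : IsOpen Ω) (hbdd : Bornology.IsBounded Ω) (hfr : (frontier Ω).Nonempty)
    (hne : ∀ y : X, (𝓝[≠] y).NeBot) {c : ℝ} (hc : 0 < c) (hcf : ∀ x ∈ Ω, c ≤ f x)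
    (hu : IsMongeSubsolution Ω f u) (hv : IsMongeSupersolution Ω f v)
    (hgu : SatisfiesBoundaryCondition Ω g u) (hgv : SatisfiesBoundaryCondition Ω g v) :
    ∀ x ∈ Ω, u x ≤ v x := by
  intro x₀ hx₀
  by_contra! hlt
  obtain ⟨B, hB0, hB⟩ := hgu.exists_abs_le hbdd hfr
  obtain ⟨B', hB'0, hB'⟩ := hgv.exists_abs_le hbdd hfr
  set a := (u x₀ - v x₀) / 4 with ha
  have ha0 : 0 < a := by rw [ha]; linarith
  obtain ⟨η, hη, hclose⟩ := exists_close_near_frontier hX hΩ hgu hgv ha0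
  -- `μ = 1 - λ`
  obtain ⟨μ, hμ0, hμ1, hμB⟩ : ∃ μ, 0 < μ ∧ μ ≤ 1 ∧ μ * B ≤ a := by
    refine ⟨min 1 (a / (B + 1)), by positivity, min_le_left _ _, ?_⟩
    have h1 : min 1 (a / (B + 1)) ≤ a / (B + 1) := min_le_right _ _
    rw [le_div_iff₀ (by positivity)] at h1
    have h2 : 0 < min 1 (a / (B + 1)) := by positivity
    nlinarith
  have hμu : ∀ x ∈ Ω, |μ * u x| ≤ a := fun x hx => by
    rw [abs_mul, abs_of_pos hμ0]
    exact (mul_le_mul_of_nonneg_left (hB x hx) hμ0.le).trans hμB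
  let S : Set X := {x | η / 2 ≤ Metric.infDist x Ωᶜ}
  have hcne : (Ωᶜ).Nonempty := by
    obtain ⟨y, hy⟩ := hfr
    rw [hΩ.frontier_eq] at hy
    exact ⟨y, hy.2⟩
  have hSΩ : S ⊆ Ω := fun x hx => by
    by_contra hcon
    have h0 : Metric.infDist x Ωᶜ = 0 := Metric.infDist_zero_of_mem hcon
    have hx' : η / 2 ≤ Metric.infDist x Ωᶜ := hx
    linarith
  have hScl : IsClosed S := isClosed_le continuous_const (Metric.continuous_infDist_pt _)
  have hin : ∀ x ∈ Ω, a < u x - v x → η ≤ Metric.infDist x Ωᶜ := fun x hx hlt' => by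
    by_contra! hcon
    obtain ⟨z, hz, hxz⟩ := (Metric.infDist_lt_iff hcne).1 hcon
    linarith [hclose x hx z hz hxz]
  have hx₀S : x₀ ∈ S := by
    have := hin x₀ hx₀ (by linarith)
    show η / 2 ≤ _
    linarith
  obtain ⟨y, hyS, hy1, hy2⟩ := exists_ekeland hScl
    (F := fun x => v x - (1 - μ) * u x)
    ((hv.1.continuousOn.mono hSΩ).sub ((hu.1.continuousOn.mono hSΩ).const_smul (1 - μ)))
    (B := -B' - B) (fun x hx => by
      have h1 := abs_le.1 (hB x (hSΩ hx))
      have h2 := abs_le.1 (hB' x (hSΩ hx))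
      nlinarith) (show 0 < μ * c / 4 by positivity) hx₀S
  have hyΩ := hSΩ hyS
  have hdy : 0 ≤ μ * c / 4 * dist x₀ y := by positivity
  have hyin : η ≤ Metric.infDist y Ωᶜ := by
    have h1 := abs_le.1 (hμu y hyΩ)
    have h2 := abs_le.1 (hμu x₀ hx₀)
    refine hin y hyΩ ?_
    nlinarith
  have hSnhds : S ∈ 𝓝 y := by
    have : ∀ᶠ x in 𝓝 y, η / 2 < Metric.infDist x Ωᶜ :=
      (Metric.continuous_infDist_pt Ωᶜ).tendsto y |>.eventually (lt_mem_nhds (by linarith))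
    exact this.mono fun x hx => le_of_lt hx
  have hfy := hcf y hyΩ
  have hev := hu.eventually_le hΩ hyΩ (show f y < f y + μ * c / 4 by
    have : 0 < μ * c / 4 := by positivity
    linarith)
  have hslope : subSlope v y ≤ f y - μ * c / 2 := by
    have hmc : μ * c ≤ c := by nlinarith
    refine subSlope_le (by linarith) fun ε hε => ?_
    filter_upwards [hev, hSnhds] with z hz1 hz2
    have hd : 0 ≤ dist y z := dist_nonneg
    have hlow : v y - v z ≤ (1 - μ) * (u y - u z) + μ * c / 4 * dist y z := by
      rcases eq_or_ne z y with rfl | hzy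
      · simp
      · linarith [hy2 z hz2 hzy]
    have h1 : (1 - μ) * (u y - u z) ≤ (1 - μ) * ((f y + μ * c / 4) * dist y z) :=
      mul_le_mul_of_nonneg_left hz1 (by linarith)
    have h2 : (1 - μ) * (f y + μ * c / 4) ≤ f y - μ * c * (3 / 4) := by
      nlinarith [mul_nonneg hμ0.le (sub_nonneg.2 hfy), mul_nonneg hμ0.le (mul_nonneg hμ0.le hc.le)]
    have h3 := mul_le_mul_of_nonneg_right h2 hd
    have h4 : 0 ≤ ε * dist y z := by positivity
    nlinarith
  have := hv.2 y hyΩ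
  have : 0 < μ * c := by positivity
  linarith

end Comparison

end MetricEikonal

open MetricEikonal in
theorem mainTheorem1 {X : Type*} [MetricSpace X] [CompleteSpace X] (hX : IsLengthSpace X)
    (Ω : Set X) (hΩ_open : IsOpen Ω) (hΩ_conn : IsConnected Ω) (hΩ_bdd : Bornology.IsBounded Ω)
    (hΩ_ne : Ω ≠ Set.univ)
    (f : X → ℝ) (hf_uc : UniformContinuousOn f Ω) (hf_pos : ∃ c : ℝ, 0 < c ∧ ∀ x ∈ Ω, c ≤ f x)
    (g : X → ℝ) (hg : ContinuousOn g (frontier Ω)) :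
    (∀ u : X → ℝ, LocallyLipschitzOn Ω u → SatisfiesBoundaryCondition Ω g u →
      [IsCSolution Ω f u, IsSSolution Ω f u, IsMongeSolution Ω f u].TFAE) ∧
    (∀ u v : X → ℝ, LocallyLipschitzOn Ω u → LocallyLipschitzOn Ω v →
      SatisfiesBoundaryCondition Ω g u → SatisfiesBoundaryCondition Ω g v →
      (IsCSolution Ω f u ∨ IsSSolution Ω f u ∨ IsMongeSolution Ω f u) →
      (IsCSolution Ω f v ∨ IsSSolution Ω f v ∨ IsMongeSolution Ω f v) →
      Set.EqOn u v Ω) := by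
  obtain ⟨c, hc, hcf⟩ := hf_pos
  have hf0 : ∀ x ∈ Ω, 0 ≤ f x := fun x hx => hc.le.trans (hcf x hx)
  have hfc := hf_uc.continuousOn
  obtain ⟨x, hx⟩ := hΩ_conn.nonempty
  obtain ⟨z, hz⟩ := (Set.ne_univ_iff_exists_notMem Ω).1 hΩ_ne
  have : Nontrivial X := ⟨x, z, by rintro rfl; exact hz hx⟩
  have hne : ∀ y : X, (𝓝[≠] y).NeBot := fun y => hX.neBot y
  have hfr : (frontier Ω).Nonempty :=
    let ⟨y, hy, _⟩ := hX.exists_frontier hΩ_open hx hz one_pos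
    ⟨y, hy⟩
  have hc_monge : ∀ u : X → ℝ, LocallyLipschitzOn Ω u → IsCSolution Ω f u →
      IsMongeSolution Ω f u := fun u hu h =>
    ⟨h.2.1.isMongeSubsolution hX hΩ_open hne hfc hf0 hu,
      h.2.2.isMongeSupersolution hΩ_open hne hfc hu⟩
  have hs_monge : ∀ u : X → ℝ, LocallyLipschitzOn Ω u → IsSSolution Ω f u →
      IsMongeSolution Ω f u := fun u hu h =>
    ⟨h.2.1.isMongeSubsolution hX hΩ_open hne hfc hf0 hu,
      h.2.2.isMongeSupersolution hX hΩ_open hne hfc hu⟩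
  refine ⟨fun u hu hgu => ?_, fun u v hu hv hgu hgv hsu hsv => ?_⟩
  · obtain ⟨B, -, hB⟩ := hgu.exists_abs_le hΩ_bdd hfr
    tfae_have 1 → 3 := hc_monge u hu
    tfae_have 2 → 3 := hs_monge u hu
    tfae_have 3 → 1 := fun h => ⟨hu.continuousOn, h.1.isCSubsolution hΩ_open hf0,
      h.isCSupersolution hX hΩ_open hne hf_uc hc hcf (B := -B)
        fun x hx => (abs_le.1 (hB x hx)).1⟩
    tfae_have 3 → 2 := fun h => ⟨hu.continuousOn, h.1.isSSubsolution hΩ_open hne hf0,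
      h.2.isSSupersolution hΩ_open hne⟩
    tfae_finish
  · have hu' : IsMongeSolution Ω f u := by
      rcases hsu with h | h | h
      exacts [hc_monge u hu h, hs_monge u hu h, h]
    have hv' : IsMongeSolution Ω f v := by
      rcases hsv with h | h | h
      exacts [hc_monge v hv h, hs_monge v hv h, h]
    exact fun x hx => le_antisymm
      (le_of_mongeSubsolution_of_mongeSupersolution hX hΩ_open hΩ_bdd hfr hne hc hcf hu'.1 hv'.2
        hgu hgv x hx)
      (le_of_mongeSubsolution_of_mongeSupersolution hX hΩ_open hΩ_bdd hfr hne hc hcf hv'.1 hu'.2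
        hgv hgu x hx)
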